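/- Let $U$ be a non-empty connected open set of points with real coordinates $(t,\phi,r)$, let $J\subseteq\mathbb{R}$ be the set of values that $r$ takes on $U$, and let $H,D$ be smooth real functions on $J$ with $D(r)\neq 0$ for all $r\in J$. Endow $U$ with the three-dimensional Gödel-type metric $$ds^2=-[dt+H(r)\,d\phi]^2+D(r)^2\,d\phi^2+dr^2 .$$ Then $U$ is locally homogeneous in space and time if and only if the two quotients $$\frac{H'(r)}{D(r)}=2\omega,\qquad \frac{D''(r)}{D(r)}=m^2$$ are both constant on $J$ (with $\omega$ and $m^2$ real constants; $m^2$ may be positive, zero or negative). This holds for local homogeneity in each of the following two senses: (a) for all points $p,q\in U$ there is a local isometry of the metric, i.e. a smooth, metric-preserving diffeomorphism from an open neighbourhood of $p$ in $U$ onto an open neighbourhood of $q$ in $U$, that maps $p$ to $q$; (b) the orbits of the local group of isometries generated by the Killing vector fields are three-dimensional, i.e. at each point $p\in U$ the values at $p$ of the smooth Killing vector fields (smooth vector fields $\xi$ with $\pounds_\xi g=0$) defined on open neighbourhoods of $p$ in $U$ span a three-dimensional space. -/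

import Mathlib

open scoped ContDiff

namespace GodelType

/-- Coordinates `(t, φ, r)` on spacetime: `x 0 = t`, `x 1 = φ`, `x 2 = r`. Tangent vectors are
given by their components in the coordinate basis `∂_t, ∂_φ, ∂_r`. -/
abbrev Coord : Type := Fin 3 → ℝ

/-- The Gödel-type metric `ds² = -[dt + H(r) dφ]² + D(r)² dφ² + dr²`, as the symmetric bilinear
form at the point `x`, evaluated on the tangent vectors `u` and `v`. -/
def metric (H D : ℝ → ℝ) (x u v : Coord) : ℝ :=
  -((u 0 + H (x 2) * u 1) * (v 0 + H (x 2) * v 1)) + D (x 2) ^ 2 * (u 1 * v 1) + u 2 * v 2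

/-- The set of values taken by the coordinate `r` on the coordinate domain `U`. -/
def radii (U : Set Coord) : Set ℝ :=
  (fun x : Coord => x 2) '' U

/-- `e` is a local isometry of the Gödel-type metric: a smooth diffeomorphism between two open
subsets (its source and its target) of `U` that pulls the metric back to itself. -/
def IsLocalIsometry (H D : ℝ → ℝ) (U : Set Coord) (e : OpenPartialHomeomorph Coord Coord) : Prop :=
  e.source ⊆ U ∧ e.target ⊆ U ∧
    ContDiffOn ℝ ∞ e e.source ∧ ContDiffOn ℝ ∞ e.symm e.target ∧
    ∀ x ∈ e.source, ∀ u v : Coord,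
      metric H D (e x) (fderiv ℝ e x u) (fderiv ℝ e x v) = metric H D x u v

/-- Local homogeneity in space and time: any point of `U` can be carried to any other one by a
local isometry. -/
def LocallyHomogeneous (H D : ℝ → ℝ) (U : Set Coord) : Prop :=
  ∀ p ∈ U, ∀ q ∈ U, ∃ e : OpenPartialHomeomorph Coord Coord,
    IsLocalIsometry H D U e ∧ p ∈ e.source ∧ e p = q

/-- The Lie derivative `£_ξ g` of the metric along the vector field `ξ`, at the point `x`,
evaluated on the vectors `u` and `w`; in components
`ξ^α ∂_α g_{μν} + g_{αν} ∂_μ ξ^α + g_{μα} ∂_ν ξ^α`. -/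
noncomputable def lieDerivMetric (H D : ℝ → ℝ) (ξ : Coord → Coord) (x u w : Coord) : ℝ :=
  fderiv ℝ (fun y => metric H D y u w) x (ξ x)
    + metric H D x (fderiv ℝ ξ x u) w + metric H D x u (fderiv ℝ ξ x w)

/-- `ξ` is a (smooth) Killing vector field on the open set `V`: `£_ξ g = 0` there. -/
def IsKillingOn (H D : ℝ → ℝ) (V : Set Coord) (ξ : Coord → Coord) : Prop :=
  ContDiffOn ℝ ∞ ξ V ∧ ∀ x ∈ V, ∀ u w : Coord, lieDerivMetric H D ξ x u w = 0

/-- The tangent space at `p` of the orbit of the local group of isometries: the space of the values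
at `p` of the Killing vector fields defined on some open neighbourhood of `p` in `U`. -/
def orbitTangent (H D : ℝ → ℝ) (U : Set Coord) (p : Coord) : Submodule ℝ Coord :=
  Submodule.span ℝ {w | ∃ V : Set Coord, IsOpen V ∧ p ∈ V ∧ V ⊆ U ∧
    ∃ ξ : Coord → Coord, IsKillingOn H D V ξ ∧ ξ p = w}

/-- Local homogeneity in space and time, in terms of the local group of isometries generated by the
Killing vector fields: all of its orbits are three-dimensional. -/
def HasThreeDimOrbits (H D : ℝ → ℝ) (U : Set Coord) : Prop :=
  ∀ p ∈ U, Module.finrank ℝ (orbitTangent H D U p) = 3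

/-- `H' / D = 2 ω` and `D'' / D = m²` are both constant on `U`. The constants are named `vort`
(for `ω`) and `msq` (for `m²`, which may have any sign). -/
def ConstantParameters (H D : ℝ → ℝ) (U : Set Coord) : Prop :=
  ∃ vort msq : ℝ, ∀ r ∈ radii U, deriv H r / D r = 2 * vort ∧ deriv (deriv D) r / D r = msq

end GodelType

/-! Everything is controlled by the radial components of Killing fields. The fields `∂_t` and `∂_φ`
are always Killing, so the question is whether there are Killing fields that move `r`.

Constancy from orbits. Equating mixed partial derivatives in the Killing equations, and using that
the radial component `Z` does not depend on `r`, yields `Z · (H'/D)' = 0` and `Z · (D''/D)' = 0`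
(`killing_integrability`, `deriv_parameters_eq_zero`). A three-dimensional orbit supplies a field
with `Z ≠ 0` at each point, and `J` is connected.

Constancy from isometries. A local isometry need not come from a Killing field. Suppose one of the
two derivatives is nonzero at `q`. Near `q` every Killing field then has `Z = 0`; in particular this
holds for the images of `∂_t` and `∂_φ` under an isometry `e` taking `p` to `q`. So `de` preserves
the `(t, φ)`-planes and sends `∂_r` to `± ∂_r`. Comparing Gram matrices along radial lines shows
that `(H'/D)²` and `D''/D` agree at `p` and `q`. As `p` is arbitrary both are constant, and
continuity removes the square.

Converse. The 1-form `dt + H dφ` has exterior derivative `2ω` times the area form of `D² dφ² + dr²`,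
a surface of constant curvature `-m²`. A Killing field equal to `∂_r` at a given point is written
explicitly, which gives the orbits. For isometries, functions `f₁`, `f₂` embedding the surface in a
quadric, and a `τ` from the Poincaré lemma, bring the metric near any point to a form depending only
on `ω` and `m²` (`exists_model_coordinates`); two such charts compose to a local isometry. -/

namespace GodelType

open Set Filter Topology

/-- The `i`-th partial derivative of a function of the coordinates. -/
noncomputable def pd (i : Fin 3) (f : Coord → ℝ) (x : Coord) : ℝ :=
  fderiv ℝ f x (Pi.single i 1)

/-! ### Calculus of coordinate partial derivatives. -/

section Partial

variable {V : Set Coord} {f g : Coord → ℝ} {x : Coord} {i j : Fin 3}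

theorem contDiffOn_pd (hV : IsOpen V) (hf : ContDiffOn ℝ ∞ f V) : ContDiffOn ℝ ∞ (pd i f) V :=
  (hf.fderiv_of_isOpen hV (m := ∞) le_rfl).clm_apply contDiffOn_const

theorem differentiableAt_of_contDiffOn (hV : IsOpen V) (hf : ContDiffOn ℝ ∞ f V) (hx : x ∈ V) :
    DifferentiableAt ℝ f x :=
  (hf.contDiffAt (hV.mem_nhds hx)).differentiableAt (by simp)

theorem pd_congr (hV : IsOpen V) (h : EqOn f g V) (hx : x ∈ V) : pd i f x = pd i g x := by
  unfold pd
  rw [(h.eventuallyEq_of_mem (hV.mem_nhds hx)).fderiv_eq]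

theorem pd_const (a : ℝ) : pd i (fun _ => a) x = 0 := by
  simp [pd]

theorem pd_add (hf : DifferentiableAt ℝ f x) (hg : DifferentiableAt ℝ g x) :
    pd i (fun y => f y + g y) x = pd i f x + pd i g x := by
  simp [pd, fderiv_fun_add hf hg]

theorem pd_sub (hf : DifferentiableAt ℝ f x) (hg : DifferentiableAt ℝ g x) :
    pd i (fun y => f y - g y) x = pd i f x - pd i g x := by
  simp [pd, fderiv_fun_sub hf hg]

theorem pd_neg : pd i (fun y => -f y) x = -pd i f x := by
  simp [pd]

theorem pd_mul (hf : DifferentiableAt ℝ f x) (hg : DifferentiableAt ℝ g x) :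
    pd i (fun y => f y * g y) x = f x * pd i g x + pd i f x * g x := by
  simp [pd, fderiv_fun_mul hf hg]; ring

/-- Symmetry of the second derivative; this is the source of all the integrability conditions. -/
theorem pd_comm (hV : IsOpen V) (hf : ContDiffOn ℝ ∞ f V) (hx : x ∈ V) :
    pd i (pd j f) x = pd j (pd i f) x := by
  have hd : DifferentiableAt ℝ (fderiv ℝ f) x :=
    ((hf.fderiv_of_isOpen hV (m := ∞) le_rfl).contDiffAt (hV.mem_nhds hx)).differentiableAt
      (by simp)
  have hs : IsSymmSndFDerivAt ℝ f x :=
    (hf.contDiffAt (hV.mem_nhds hx)).isSymmSndFDerivAt 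
      (by simpa using WithTop.coe_le_coe.2 (le_top (a := (2 : ℕ∞))))
  have key : ∀ k l : Fin 3,
      pd k (pd l f) x = fderiv ℝ (fderiv ℝ f) x (Pi.single k 1) (Pi.single l 1) := by
    intro k l
    have := hd.hasFDerivAt.clm_apply (hasFDerivAt_const (Pi.single l 1 : Coord) x)
    unfold pd
    rw [this.fderiv]
    simp
  rw [key, key, hs]

theorem hasFDerivAt_radial {G : ℝ → ℝ} {G' : ℝ} (hG : HasDerivAt G G' (x 2)) :
    HasFDerivAt (fun y : Coord => G (y 2)) (G' • ContinuousLinearMap.proj (R := ℝ) 2) x :=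
  hG.comp_hasFDerivAt x (hasFDerivAt_apply 2 x)

theorem pd_radial {G : ℝ → ℝ} (hG : DifferentiableAt ℝ G (x 2)) :
    pd 0 (fun y => G (y 2)) x = 0 ∧ pd 1 (fun y => G (y 2)) x = 0 ∧
      pd 2 (fun y => G (y 2)) x = deriv G (x 2) := by
  simp [pd, (hasFDerivAt_radial hG.hasDerivAt).fderiv]

theorem fderiv_eq_sum_pd (u : Coord) :
    fderiv ℝ f x u = u 0 * pd 0 f x + u 1 * pd 1 f x + u 2 * pd 2 f x := by
  have hu : u = u 0 • Pi.single 0 1 + u 1 • Pi.single 1 1 + u 2 • Pi.single 2 1 := by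
    ext i; fin_cases i <;> simp
  conv_lhs => rw [hu]
  simp [pd]

theorem fderiv_comp_eq_pd {ξ : Coord → Coord} (hξ : DifferentiableAt ℝ ξ x) (u : Coord)
    (k : Fin 3) :
    fderiv ℝ ξ x u k = u 0 * pd 0 (fun y => ξ y k) x + u 1 * pd 1 (fun y => ξ y k) x
      + u 2 * pd 2 (fun y => ξ y k) x := by
  rw [← fderiv_eq_sum_pd, fderiv_apply hξ]
  rfl

end Partial

/-! ### The range of `r`, and the Lie derivative of the metric. -/

section Radii

variable {U : Set Coord}

theorem isOpen_radii (hU : IsOpen U) : IsOpen (radii U) :=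
  (isOpenMap_eval (2 : Fin 3)) U hU

theorem isPreconnected_radii (hU : IsConnected U) : IsPreconnected (radii U) :=
  hU.isPreconnected.image _ (continuous_apply 2).continuousOn

theorem mem_radii {x : Coord} (hx : x ∈ U) : x 2 ∈ radii U := ⟨x, hx, rfl⟩

theorem contDiffOn_radial {G : ℝ → ℝ} {V : Set Coord} (hG : ContDiffOn ℝ ∞ G (radii U))
    (hV : V ⊆ U) : ContDiffOn ℝ ∞ (fun x : Coord => G (x 2)) V :=
  hG.comp (contDiff_apply ℝ ℝ (2 : Fin 3)).contDiffOn fun _ hx => mem_radii (hV hx)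

end Radii

theorem hasFDerivAt_metric {H D : ℝ → ℝ} {x : Coord} (u w : Coord)
    (hH : DifferentiableAt ℝ H (x 2)) (hD : DifferentiableAt ℝ D (x 2)) :
    HasFDerivAt (fun y => metric H D y u w)
      ((-(deriv H (x 2) * u 1 * (w 0 + H (x 2) * w 1)
          + (u 0 + H (x 2) * u 1) * (deriv H (x 2) * w 1))
        + 2 * D (x 2) * deriv D (x 2) * (u 1 * w 1)) •
          ContinuousLinearMap.proj (R := ℝ) (2 : Fin 3)) x := by
  have h1 := (((hH.hasDerivAt.mul_const (u 1)).const_add (u 0)).mul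
    ((hH.hasDerivAt.mul_const (w 1)).const_add (w 0))).neg
  have h2 := (hD.hasDerivAt.pow 2).mul_const (u 1 * w 1)
  refine ((hasFDerivAt_radial ((h1.add h2).add_const (u 2 * w 2))).congr_fderiv ?_)
  congr 1
  simp

theorem lieDerivMetric_eq {H D : ℝ → ℝ} {ξ : Coord → Coord} {x : Coord} (u w : Coord)
    (hH : DifferentiableAt ℝ H (x 2)) (hD : DifferentiableAt ℝ D (x 2)) :
    lieDerivMetric H D ξ x u w =
      (-(deriv H (x 2) * u 1 * (w 0 + H (x 2) * w 1)
          + (u 0 + H (x 2) * u 1) * (deriv H (x 2) * w 1))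
        + 2 * D (x 2) * deriv D (x 2) * (u 1 * w 1)) * ξ x 2
      + metric H D x (fderiv ℝ ξ x u) w + metric H D x u (fderiv ℝ ξ x w) := by
  rw [lieDerivMetric, (hasFDerivAt_metric u w hH hD).fderiv]
  rfl

end GodelType

/-! ### Integrability conditions of the Killing equations. -/

namespace GodelType

open Set Filter Topology

/-- Integrability conditions of the Killing equations for the components `A`, `B`, `Z` of a vector
field, where `H'`, `H''`, `D'`, `D''`, `D'''` are the successive radial derivatives of the metric
functions. -/
theorem killing_integrability {V : Set Coord} (hV : IsOpen V)
    {A B Z H H1 H2 D D1 D2 D3 : Coord → ℝ}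
    (sA : ContDiffOn ℝ ∞ A V) (sB : ContDiffOn ℝ ∞ B V) (sZ : ContDiffOn ℝ ∞ Z V)
    (sH : ContDiffOn ℝ ∞ H V) (sH1 : ContDiffOn ℝ ∞ H1 V) (sH2 : ContDiffOn ℝ ∞ H2 V)
    (sD : ContDiffOn ℝ ∞ D V) (sD1 : ContDiffOn ℝ ∞ D1 V) (sD2 : ContDiffOn ℝ ∞ D2 V)
    (hH : ∀ x ∈ V, pd 0 H x = 0 ∧ pd 1 H x = 0 ∧ pd 2 H x = H1 x)
    (hH1 : ∀ x ∈ V, pd 0 H1 x = 0 ∧ pd 1 H1 x = 0 ∧ pd 2 H1 x = H2 x)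
    (hD : ∀ x ∈ V, pd 0 D x = 0 ∧ pd 1 D x = 0 ∧ pd 2 D x = D1 x)
    (hD1 : ∀ x ∈ V, pd 0 D1 x = 0 ∧ pd 1 D1 x = 0 ∧ pd 2 D1 x = D2 x)
    (hD2 : ∀ x ∈ V, pd 2 D2 x = D3 x)
    (hD0 : ∀ x ∈ V, D x ≠ 0)
    (ett : ∀ x ∈ V, pd 0 A x = -(H x * pd 0 B x))
    (err : ∀ x ∈ V, pd 2 Z x = 0)
    (etr : ∀ x ∈ V, pd 2 A x = pd 0 Z x - H x * pd 2 B x)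
    (etp : ∀ x ∈ V, pd 1 A x =
      -(H1 x * Z x) - H x * pd 1 B x + D x * D x * pd 0 B x)
    (erp : ∀ x ∈ V, D x * D x * pd 2 B x = H x * pd 0 Z x - pd 1 Z x)
    (epp : ∀ x ∈ V, D x * pd 1 B x = H x * D x * pd 0 B x - D1 x * Z x)
    {x : Coord} (hx : x ∈ V) (hZ : Z x ≠ 0) :
    H2 x * D x - H1 x * D1 x = 0 ∧ D x * D3 x - D1 x * D2 x = 0 := by
  have dif {f : Coord → ℝ} (hf : ContDiffOn ℝ ∞ f V) {y : Coord} (hy : y ∈ V) :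
      DifferentiableAt ℝ f y := differentiableAt_of_contDiffOn hV hf hy
  have spd {f : Coord → ℝ} {i : Fin 3} (hf : ContDiffOn ℝ ∞ f V) : ContDiffOn ℝ ∞ (pd i f) V :=
    contDiffOn_pd hV hf
  have zero {f : Coord → ℝ} (i : Fin 3) (h : ∀ y ∈ V, f y = 0) {y : Coord} (hy : y ∈ V) :
      pd i f y = 0 := by
    rw [pd_congr hV (g := fun _ => 0) h hy, pd_const]
  have dB0 {y : Coord} (hy : y ∈ V) : DifferentiableAt ℝ (pd 0 B) y := dif (spd sB) hy
  have dB1 {y : Coord} (hy : y ∈ V) : DifferentiableAt ℝ (pd 1 B) y := dif (spd sB) hy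
  have dB2 {y : Coord} (hy : y ∈ V) : DifferentiableAt ℝ (pd 2 B) y := dif (spd sB) hy
  have dZ0 {y : Coord} (hy : y ∈ V) : DifferentiableAt ℝ (pd 0 Z) y := dif (spd sZ) hy
  have dZ1 {y : Coord} (hy : y ∈ V) : DifferentiableAt ℝ (pd 1 Z) y := dif (spd sZ) hy
  -- The two expressions for `A_tr`, from the `tt` and `tr` equations, are equated.
  have e2 : ∀ y ∈ V, H1 y * pd 0 B y + pd 0 (pd 0 Z) y = 0 := by
    intro y hy
    have h1 := pd_congr (i := 2) hV ett hy
    have h2 := pd_congr (i := 0) hV etr hy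
    have := dif sH hy
    have := dB0 hy
    have := dB2 hy
    have := dZ0 hy
    simp (disch := fun_prop) only [pd_neg, pd_mul, pd_sub, hH y hy] at h1 h2
    rw [pd_comm hV sA hy, pd_comm hV sB hy] at h1
    linarith
  have e5t : ∀ y ∈ V, D y * D y * pd 2 (pd 0 B) y = H y * pd 0 (pd 0 Z) y - pd 0 (pd 1 Z) y := by
    intro y hy
    have h1 := pd_congr (i := 0) hV erp hy
    have := dif sH hy
    have := dif sD hy
    have := dB2 hy
    have := dZ0 hy
    have := dZ1 hy
    simp (disch := fun_prop) only [pd_mul, pd_sub, hH y hy, hD y hy] at h1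
    rw [pd_comm hV sB hy] at h1
    linarith
  have e5p : ∀ y ∈ V, D y * D y * pd 2 (pd 1 B) y = H y * pd 0 (pd 1 Z) y - pd 1 (pd 1 Z) y := by
    intro y hy
    have h1 := pd_congr (i := 1) hV erp hy
    have := dif sH hy
    have := dif sD hy
    have := dB2 hy
    have := dZ0 hy
    have := dZ1 hy
    simp (disch := fun_prop) only [pd_mul, pd_sub, hH y hy, hD y hy] at h1
    rw [pd_comm hV sB hy, pd_comm hV sZ hy] at h1
    linarith
  -- The same for `A_rφ`, from the `tr` and `tφ` equations. The coefficient of `Z` is the numerator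
  -- of `(H'/D)'`.
  have e4 : ∀ y ∈ V, (H2 y * D y - H1 y * D1 y) * Z y + 2 * D y * pd 0 (pd 1 Z) y
      - 2 * H y * D y * pd 0 (pd 0 Z) y - 2 * D y * D y * D1 y * pd 0 B y = 0 := by
    intro y hy
    have h1 := pd_congr (i := 1) hV etr hy
    have h2 := pd_congr (i := 2) hV etp hy
    have := dif sH hy
    have := dif sH1 hy
    have := dif sD hy
    have := dif sZ hy
    have := dB0 hy
    have := dB1 hy
    have := dB2 hy
    have := dZ0 hy
    simp (disch := fun_prop) only [pd_mul, pd_sub, pd_add, pd_neg, hH y hy, hH1 y hy, hD y hy,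
      err y hy] at h1 h2
    rw [pd_comm hV sA hy, pd_comm hV sB hy, pd_comm hV sZ hy] at h1
    have h3 := e5t y hy
    have h4 := e2 y hy
    have h5 := epp y hy
    linear_combination D y * (h2 - h1) - H1 y * h5 + D y * h3 - H y * D y * h4
  -- The same for `B_rφ`, from the `rφ` and `φφ` equations.
  have e1 : ∀ y ∈ V, H1 y * D y * D y * pd 0 B y + H y * H y * pd 0 (pd 0 Z) y
      - 2 * H y * pd 0 (pd 1 Z) y + pd 1 (pd 1 Z) y - (D2 y * D y - D1 y * D1 y) * Z y = 0 := by
    intro y hy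
    have h1 := pd_congr (i := 2) hV epp hy
    have := dif sH hy
    have := dif sD hy
    have := dif sD1 hy
    have := dif sZ hy
    have := dB0 hy
    have := dB1 hy
    simp (disch := fun_prop) only [pd_mul, pd_sub, hH y hy, hD y hy, hD1 y hy, err y hy] at h1
    have h2 := e5t y hy
    have h3 := e5p y hy
    have h4 := epp y hy
    linear_combination (-D y) * h1 + h3 + D1 y * h4 - H y * h2
  -- Since `Z_r = 0`, the `t` and `φ` derivatives of `Z` are constant in `r` too, so differentiating
  -- in `r` brings in no third derivatives of `Z`.
  have ztt : ∀ y ∈ V, pd 2 (pd 0 (pd 0 Z)) y = 0 := by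
    intro y hy
    rw [pd_comm hV (spd sZ) hy]
    refine zero 0 (fun z hz => ?_) hy
    rw [pd_comm hV sZ hz]
    exact zero 0 err hz
  have ztp : ∀ y ∈ V, pd 2 (pd 0 (pd 1 Z)) y = 0 := by
    intro y hy
    rw [pd_comm hV (spd sZ) hy]
    refine zero 0 (fun z hz => ?_) hy
    rw [pd_comm hV sZ hz]
    exact zero 1 err hz
  have zpp : ∀ y ∈ V, pd 2 (pd 1 (pd 1 Z)) y = 0 := by
    intro y hy
    rw [pd_comm hV (spd sZ) hy]
    refine zero 1 (fun z hz => ?_) hy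
    rw [pd_comm hV sZ hz]
    exact zero 1 err hz
  have e2r : ∀ y ∈ V, H2 y * D y * D y * pd 0 B y
      + H1 y * (H y * pd 0 (pd 0 Z) y - pd 0 (pd 1 Z) y) = 0 := by
    intro y hy
    have h1 := zero 2 e2 hy
    have := dif sH1 hy
    have := dB0 hy
    have : DifferentiableAt ℝ (pd 0 (pd 0 Z)) y := dif (spd (spd sZ)) hy
    simp (disch := fun_prop) only [pd_mul, pd_add, hH1 y hy, ztt y hy] at h1
    linear_combination D y * D y * h1 - H1 y * e5t y hy
  -- Write this as `T E = 0`. One more `r`-derivative gives `T' E + T E' = 0`, and `e4` turns `D E'`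
  -- into `D' E + 2 T Z`. Multiplying by `T` and using `T E = 0` leaves `2 T³ Z = 0`.
  have hTE : ∀ y ∈ V, (H2 y * D y - H1 y * D1 y)
      * (2 * (D y * D y * pd 0 B y) + H1 y * Z y) = 0 := by
    intro y hy
    linear_combination 2 * D y * e2r y hy + H1 y * e4 y hy
  have hT : ∀ y ∈ V, Z y ≠ 0 → H2 y * D y - H1 y * D1 y = 0 := by
    intro y hy hZy
    have h1 := zero 2 hTE hy
    have := dif sH1 hy
    have := dif sH2 hy
    have := dif sD hy
    have := dif sD1 hy
    have := dif sZ hy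
    have := dB0 hy
    rw [pd_mul (by fun_prop) (by fun_prop)] at h1
    have h2 : pd 2 (fun y => 2 * (D y * D y * pd 0 B y) + H1 y * Z y) y =
        4 * D y * D1 y * pd 0 B y + 2 * (H y * pd 0 (pd 0 Z) y - pd 0 (pd 1 Z) y)
          + H2 y * Z y := by
      simp (disch := fun_prop) only [pd_mul, pd_add, hH1 y hy, hD y hy, err y hy, pd_const]
      linear_combination 2 * e5t y hy
    rw [h2] at h1
    have h3 := hTE y hy
    have h4 := e4 y hy
    set T := H2 y * D y - H1 y * D1 y with hTdef
    set T' := pd 2 (fun y => H2 y * D y - H1 y * D1 y) y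
    have h5 : T ^ 3 * (2 * Z y) = 0 := by
      linear_combination T * D y * h1 - D y * T' * h3 - T * D1 y * h3 + T ^ 2 * h4
        + T ^ 2 * Z y * hTdef
    simpa [hZy] using h5
  refine ⟨hT x hx hZ, ?_⟩
  have h1 := zero 2 e1 hx
  have := dif sH hx
  have := dif sH1 hx
  have := dif sD hx
  have := dif sD1 hx
  have := dif sD2 hx
  have := dif sZ hx
  have := dB0 hx
  have : DifferentiableAt ℝ (pd 0 (pd 0 Z)) x := dif (spd (spd sZ)) hx
  have : DifferentiableAt ℝ (pd 0 (pd 1 Z)) x := dif (spd (spd sZ)) hx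
  have : DifferentiableAt ℝ (pd 1 (pd 1 Z)) x := dif (spd (spd sZ)) hx
  simp (disch := fun_prop) only [pd_mul, pd_sub, pd_add, pd_const, hH x hx, hH1 x hx, hD x hx,
    hD1 x hx, hD2 x hx, err x hx, ztt x hx, ztp x hx, zpp x hx] at h1
  have h2 := hT x hx hZ
  have h3 := e5t x hx
  have h4 := e4 x hx
  -- The `r`-derivative of `e1`, simplified by `e4` and by the vanishing of `T`; the last factor is
  -- the numerator of `(D''/D)'`.
  have h6 : D x * (Z x * (D x * D3 x - D1 x * D2 x)) = 0 := by
    linear_combination (-D x) * h1 + D x * H1 x * h3 - 3 / 2 * H1 x * h4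
      + (D x * D x * pd 0 B x + 3 / 2 * H1 x * Z x) * h2
  simpa [hZ, hD0 x hx] using h6

end GodelType

/-! ### Three-dimensional orbits force constant quotients. -/

namespace GodelType

open Set Filter Topology

variable {H D : ℝ → ℝ} {U V : Set Coord}

theorem lieDerivMetric_single {ξ : Coord → Coord} {x : Coord}
    (hH : DifferentiableAt ℝ H (x 2)) (hD : DifferentiableAt ℝ D (x 2))
    (hξ : DifferentiableAt ℝ ξ x) (i j : Fin 3) :
    lieDerivMetric H D ξ x (Pi.single i 1) (Pi.single j 1) =
      (-(deriv H (x 2) * (Pi.single i 1 : Coord) 1 * ((Pi.single j 1 : Coord) 0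
            + H (x 2) * (Pi.single j 1 : Coord) 1)
          + ((Pi.single i 1 : Coord) 0 + H (x 2) * (Pi.single i 1 : Coord) 1)
            * (deriv H (x 2) * (Pi.single j 1 : Coord) 1))
        + 2 * D (x 2) * deriv D (x 2) * ((Pi.single i 1 : Coord) 1 * (Pi.single j 1 : Coord) 1))
          * ξ x 2
      + metric H D x (fun k => pd i (fun y => ξ y k) x) (Pi.single j 1)
      + metric H D x (Pi.single i 1) (fun k => pd j (fun y => ξ y k) x) := by
  have h (l : Fin 3) : fderiv ℝ ξ x (Pi.single l 1) = fun k => pd l (fun y => ξ y k) x := by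
    ext k
    rw [fderiv_comp_eq_pd hξ]
    fin_cases l <;> simp
  rw [lieDerivMetric_eq _ _ hH hD, h, h]

theorem differentiableAt_radii {G : ℝ → ℝ} (hU : IsOpen U) (hG : ContDiffOn ℝ ∞ G (radii U))
    {r : ℝ} (hr : r ∈ radii U) : DifferentiableAt ℝ G r :=
  (hG.contDiffAt ((isOpen_radii hU).mem_nhds hr)).differentiableAt (by simp)

theorem contDiffOn_deriv_radii {G : ℝ → ℝ} (hU : IsOpen U) (hG : ContDiffOn ℝ ∞ G (radii U)) :
    ContDiffOn ℝ ∞ (deriv G) (radii U) :=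
  hG.deriv_of_isOpen (isOpen_radii hU) le_rfl

theorem contDiffOn_quotient {F G : ℝ → ℝ} {s : Set ℝ} (hF : ContDiffOn ℝ ∞ F s)
    (hG : ContDiffOn ℝ ∞ G s) (hG0 : ∀ r ∈ s, G r ≠ 0) :
    ContDiffOn ℝ ∞ (fun r => F r / G r) s := hF.div hG hG0

/-- A Killing vector field moving `r` at `p` forces the derivatives of `H' / D` and `D'' / D` to
vanish there. -/
theorem deriv_parameters_eq_zero (hU : IsOpen U) (hH : ContDiffOn ℝ ∞ H (radii U))
    (hD : ContDiffOn ℝ ∞ D (radii U)) (hD0 : ∀ r ∈ radii U, D r ≠ 0)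
    (hV : IsOpen V) (hVU : V ⊆ U) {ξ : Coord → Coord} (hξ : IsKillingOn H D V ξ) {p : Coord}
    (hp : p ∈ V) (hp2 : ξ p 2 ≠ 0) :
    deriv (fun r => deriv H r / D r) (p 2) = 0 ∧
      deriv (fun r => deriv (deriv D) r / D r) (p 2) = 0 := by
  obtain ⟨hξs, hξL⟩ := hξ
  have sξ (k : Fin 3) : ContDiffOn ℝ ∞ (fun y => ξ y k) V := contDiffOn_pi.1 hξs k
  have hH1 := contDiffOn_deriv_radii hU hH
  have hH2 := contDiffOn_deriv_radii hU hH1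
  have hD1 := contDiffOn_deriv_radii hU hD
  have hD2 := contDiffOn_deriv_radii hU hD1
  have mem {x : Coord} (hx : x ∈ V) : x 2 ∈ radii U := mem_radii (hVU hx)
  have dif {G : ℝ → ℝ} (hG : ContDiffOn ℝ ∞ G (radii U)) {x : Coord} (hx : x ∈ V) :
      DifferentiableAt ℝ G (x 2) := differentiableAt_radii hU hG (mem hx)
  have L {x : Coord} (hx : x ∈ V) (i j : Fin 3) :=
    (lieDerivMetric_single (dif hH hx) (dif hD hx)
      ((hξs.contDiffAt (hV.mem_nhds hx)).differentiableAt (by simp)) i j).symm.trans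
      (hξL x hx (Pi.single i 1) (Pi.single j 1))
  have ett : ∀ x ∈ V, pd 0 (fun y => ξ y 0) x = -(H (x 2) * pd 0 (fun y => ξ y 1) x) := by
    intro x hx
    have := L hx 0 0
    simp [metric] at this
    linarith
  have err : ∀ x ∈ V, pd 2 (fun y => ξ y 2) x = 0 := by
    intro x hx
    have := L hx 2 2
    simp [metric] at this
    linarith
  have etr : ∀ x ∈ V, pd 2 (fun y => ξ y 0) x =
      pd 0 (fun y => ξ y 2) x - H (x 2) * pd 2 (fun y => ξ y 1) x := by
    intro x hx
    have := L hx 0 2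
    simp [metric] at this
    linarith
  have etp : ∀ x ∈ V, pd 1 (fun y => ξ y 0) x = -(deriv H (x 2) * ξ x 2)
      - H (x 2) * pd 1 (fun y => ξ y 1) x + D (x 2) * D (x 2) * pd 0 (fun y => ξ y 1) x := by
    intro x hx
    have := L hx 0 1
    simp [metric] at this
    have h2 := ett x hx
    linear_combination -this - H (x 2) * h2
  have erp : ∀ x ∈ V, D (x 2) * D (x 2) * pd 2 (fun y => ξ y 1) x =
      H (x 2) * pd 0 (fun y => ξ y 2) x - pd 1 (fun y => ξ y 2) x := by
    intro x hx
    have := L hx 1 2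
    simp [metric] at this
    have h2 := etr x hx
    linear_combination this + H (x 2) * h2
  have epp : ∀ x ∈ V, D (x 2) * pd 1 (fun y => ξ y 1) x =
      H (x 2) * D (x 2) * pd 0 (fun y => ξ y 1) x - deriv D (x 2) * ξ x 2 := by
    intro x hx
    have := L hx 1 1
    simp [metric] at this
    have h2 := etp x hx
    refine mul_left_cancel₀ (hD0 _ (mem hx)) ?_
    linear_combination this / 2 + H (x 2) * h2
  have key := killing_integrability hV (A := fun y => ξ y 0) (B := fun y => ξ y 1)
    (Z := fun y => ξ y 2) (H := fun y => H (y 2)) (H1 := fun y => deriv H (y 2))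
    (H2 := fun y => deriv (deriv H) (y 2)) (D := fun y => D (y 2))
    (D1 := fun y => deriv D (y 2)) (D2 := fun y => deriv (deriv D) (y 2))
    (D3 := fun y => deriv (deriv (deriv D)) (y 2))
    (sξ 0) (sξ 1) (sξ 2) (contDiffOn_radial hH hVU) (contDiffOn_radial hH1 hVU)
    (contDiffOn_radial hH2 hVU) (contDiffOn_radial hD hVU) (contDiffOn_radial hD1 hVU)
    (contDiffOn_radial hD2 hVU) (fun x hx => pd_radial (dif hH hx))
    (fun x hx => pd_radial (dif hH1 hx)) (fun x hx => pd_radial (dif hD hx))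
    (fun x hx => pd_radial (dif hD1 hx)) (fun x hx => (pd_radial (dif hD2 hx)).2.2)
    (fun x hx => hD0 _ (mem hx)) ett err etr etp erp epp hp hp2
  constructor
  · rw [deriv_fun_div (dif hH1 hp) (dif hD hp) (hD0 _ (mem hp)), div_eq_zero_iff]
    exact .inl key.1
  · rw [deriv_fun_div (dif hD2 hp) (dif hD hp) (hD0 _ (mem hp)), div_eq_zero_iff]
    left
    linarith [key.2]

theorem eq_of_deriv_eq_zero_on_radii (hU : IsOpen U) (hUc : IsConnected U) {F : ℝ → ℝ}
    (hF : ContDiffOn ℝ ∞ F (radii U)) (h : ∀ r ∈ radii U, deriv F r = 0) {r s : ℝ}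
    (hr : r ∈ radii U) (hs : s ∈ radii U) : F r = F s :=
  (isOpen_radii hU).is_const_of_deriv_eq_zero (isPreconnected_radii hUc)
    (hF.differentiableOn (by simp)) h hr hs

theorem constantParameters_of_forall_eq {p : Coord}
    (h1 : ∀ x ∈ U, deriv H (x 2) / D (x 2) = deriv H (p 2) / D (p 2))
    (h2 : ∀ x ∈ U, deriv (deriv D) (x 2) / D (x 2) = deriv (deriv D) (p 2) / D (p 2)) :
    ConstantParameters H D U := by
  refine ⟨deriv H (p 2) / D (p 2) / 2, deriv (deriv D) (p 2) / D (p 2), ?_⟩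
  rintro _ ⟨x, hx, rfl⟩
  exact ⟨by rw [h1 x hx]; ring, h2 x hx⟩

/-- If no Killing field moved `r`, the orbit tangent would lie in the plane `w 2 = 0`. -/
theorem exists_killing_of_finrank_orbitTangent {p : Coord}
    (h : Module.finrank ℝ (orbitTangent H D U p) = 3) :
    ∃ V : Set Coord, IsOpen V ∧ p ∈ V ∧ V ⊆ U ∧
      ∃ ξ : Coord → Coord, IsKillingOn H D V ξ ∧ ξ p 2 ≠ 0 := by
  by_contra! hcon
  have htop : orbitTangent H D U p = ⊤ :=
    Submodule.eq_top_of_finrank_eq (by simpa using h)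
  have hle : orbitTangent H D U p ≤ LinearMap.ker (LinearMap.proj (R := ℝ) (2 : Fin 3)) := by
    refine Submodule.span_le.2 ?_
    rintro w ⟨V, hV, hpV, hVU, ξ, hξ, rfl⟩
    exact hcon V hV hpV hVU ξ hξ
  have : (Pi.single 2 1 : Coord) ∈ orbitTangent H D U p := htop ▸ Submodule.mem_top
  simpa using hle this

theorem HasThreeDimOrbits.constantParameters (hU : IsOpen U) (hUc : IsConnected U)
    (hH : ContDiffOn ℝ ∞ H (radii U)) (hD : ContDiffOn ℝ ∞ D (radii U))
    (hD0 : ∀ r ∈ radii U, D r ≠ 0) (h : HasThreeDimOrbits H D U) :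
    ConstantParameters H D U := by
  obtain ⟨p, hp⟩ := hUc.nonempty
  have key : ∀ r ∈ radii U, deriv (fun r => deriv H r / D r) r = 0 ∧
      deriv (fun r => deriv (deriv D) r / D r) r = 0 := by
    rintro _ ⟨x, hx, rfl⟩
    obtain ⟨V, hV, hxV, hVU, ξ, hξ, hx2⟩ := exists_killing_of_finrank_orbitTangent (h x hx)
    exact deriv_parameters_eq_zero hU hH hD hD0 hV hVU hξ hxV hx2
  have hD2 := contDiffOn_deriv_radii hU (contDiffOn_deriv_radii hU hD)
  exact constantParameters_of_forall_eq
    (fun x hx => eq_of_deriv_eq_zero_on_radii hU hUc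
      (contDiffOn_quotient (contDiffOn_deriv_radii hU hH) hD hD0) (fun r hr => (key r hr).1)
      (mem_radii hx) (mem_radii hp))
    (fun x hx => eq_of_deriv_eq_zero_on_radii hU hUc
      (contDiffOn_quotient hD2 hD hD0) (fun r hr => (key r hr).2)
      (mem_radii hx) (mem_radii hp))

end GodelType

/-! ### Isometries transport Killing fields and compare radial profiles. -/

namespace GodelType

open Set Filter Topology

variable {H D : ℝ → ℝ} {U V : Set Coord}

/-- The derivative has the shape of `lieDerivMetric_eq`, so that a Lie derivative can be read off
from a curve. -/
theorem hasDerivAt_metric_curve {y a b : ℝ → Coord} {y' a' b' : Coord} {s : ℝ}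
    (hH : DifferentiableAt ℝ H (y s 2)) (hD : DifferentiableAt ℝ D (y s 2))
    (hy : HasDerivAt y y' s) (ha : HasDerivAt a a' s) (hb : HasDerivAt b b' s) :
    HasDerivAt (fun s => metric H D (y s) (a s) (b s))
      ((-(deriv H (y s 2) * a s 1 * (b s 0 + H (y s 2) * b s 1)
          + (a s 0 + H (y s 2) * a s 1) * (deriv H (y s 2) * b s 1))
        + 2 * D (y s 2) * deriv D (y s 2) * (a s 1 * b s 1)) * y' 2
      + metric H D (y s) a' (b s) + metric H D (y s) (a s) b') s := by
  have hy2 := (hasDerivAt_pi.1 hy) 2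
  have hHs : HasDerivAt (fun s => H (y s 2)) (deriv H (y s 2) * y' 2) s :=
    hH.hasDerivAt.comp s hy2
  have hDs : HasDerivAt (fun s => D (y s 2)) (deriv D (y s 2) * y' 2) s :=
    hD.hasDerivAt.comp s hy2
  have ha := hasDerivAt_pi.1 ha
  have hb := hasDerivAt_pi.1 hb
  have h := ((((ha 0).add (hHs.mul (ha 1))).mul ((hb 0).add (hHs.mul (hb 1)))).neg.add
    ((hDs.pow 2).mul ((ha 1).mul (hb 1)))).add ((ha 2).mul (hb 2))
  refine h.congr_deriv ?_
  simp [metric]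
  ring

section Isometry

variable {e : OpenPartialHomeomorph Coord Coord} {x : Coord}

theorem IsLocalIsometry.differentiableAt (he : IsLocalIsometry H D U e) (hx : x ∈ e.source) :
    DifferentiableAt ℝ e x :=
  (he.2.2.1.contDiffAt (e.open_source.mem_nhds hx)).differentiableAt (by simp)

theorem IsLocalIsometry.differentiableAt_symm (he : IsLocalIsometry H D U e) (hx : x ∈ e.target) :
    DifferentiableAt ℝ e.symm x :=
  (he.2.2.2.1.contDiffAt (e.open_target.mem_nhds hx)).differentiableAt (by simp)

theorem IsLocalIsometry.fderiv_surjective (he : IsLocalIsometry H D U e) (hx : x ∈ e.source) :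
    Function.Surjective (fderiv ℝ e x) := by
  intro w
  have hy := e.map_source hx
  have h1 : HasFDerivAt e (fderiv ℝ e x) (e.symm (e x)) := by
    rw [e.left_inv hx]
    exact (he.differentiableAt hx).hasFDerivAt
  have h2 := h1.comp (e x) (he.differentiableAt_symm hy).hasFDerivAt
  have h3 : HasFDerivAt (e ∘ e.symm) (ContinuousLinearMap.id ℝ Coord) (e x) :=
    (hasFDerivAt_id (e x)).congr_of_eventuallyEq <| by
      filter_upwards [e.open_target.mem_nhds hy] with z hz using e.right_inv hz
  exact ⟨fderiv ℝ e.symm (e x) w, DFunLike.congr_fun (h2.unique h3) w⟩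

theorem IsLocalIsometry.differentiableAt_fderiv (he : IsLocalIsometry H D U e)
    (hx : x ∈ e.source) : DifferentiableAt ℝ (fderiv ℝ e) x :=
  ((he.2.2.1.fderiv_of_isOpen e.open_source (m := ∞) le_rfl).contDiffAt
    (e.open_source.mem_nhds hx)).differentiableAt (by simp)

theorem IsLocalIsometry.hasFDerivAt_fderiv_apply (he : IsLocalIsometry H D U e)
    (hx : x ∈ e.source) (v : Coord) :
    HasFDerivAt (fun z => fderiv ℝ e z v) ((fderiv ℝ (fderiv ℝ e) x).flip v) x := by
  refine ((he.differentiableAt_fderiv hx).hasFDerivAt.clm_apply (hasFDerivAt_const v x)).congr_fderiv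
    ?_
  ext u
  simp

theorem IsLocalIsometry.snd_fderiv_symm (he : IsLocalIsometry H D U e)
    (hx : x ∈ e.source) (u v : Coord) :
    fderiv ℝ (fderiv ℝ e) x u v = fderiv ℝ (fderiv ℝ e) x v u :=
  ((he.2.2.1.contDiffAt (e.open_source.mem_nhds hx)).isSymmSndFDerivAt
    (by simpa using WithTop.coe_le_coe.2 (le_top (a := (2 : ℕ∞))))) u v

/-- A local isometry carries the Killing vector fields `∂_t`, `∂_φ` to Killing vector fields. -/
theorem IsLocalIsometry.isKillingOn_push (hU : IsOpen U) (hH : ContDiffOn ℝ ∞ H (radii U))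
    (hD : ContDiffOn ℝ ∞ D (radii U)) (he : IsLocalIsometry H D U e) {v : Coord} (hv : v 2 = 0) :
    IsKillingOn H D e.target (fun y => fderiv ℝ e (e.symm y) v) := by
  constructor
  · exact ((he.2.2.1.fderiv_of_isOpen e.open_source (m := ∞) le_rfl).clm_apply
      contDiffOn_const).comp he.2.2.2.1 fun y hy => e.map_target hy
  · intro y hy u' w'
    obtain ⟨x, hx, rfl⟩ : ∃ x ∈ e.source, e x = y := ⟨e.symm y, e.map_target hy, e.right_inv hy⟩
    obtain ⟨u, rfl⟩ := he.fderiv_surjective hx u'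
    obtain ⟨w, rfl⟩ := he.fderiv_surjective hx w'
    have hr : e x 2 ∈ radii U := mem_radii (he.2.1 hy)
    have hη : DifferentiableAt ℝ (fun y => fderiv ℝ e (e.symm y) v) (e x) := by
      have h := he.hasFDerivAt_fderiv_apply hx v
      nth_rewrite 2 [← e.left_inv hx] at h
      exact (h.comp (e x) (he.differentiableAt_symm hy).hasFDerivAt).differentiableAt
    have hDη (z : Coord) : fderiv ℝ (fun y => fderiv ℝ e (e.symm y) v) (e x) (fderiv ℝ e x z)
        = fderiv ℝ (fderiv ℝ e) x z v := by
      have h1 := hη.hasFDerivAt.comp x (he.differentiableAt hx).hasFDerivAt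
      have h2 := (he.hasFDerivAt_fderiv_apply hx v).congr_of_eventuallyEq
        (f₁ := (fun y => fderiv ℝ e (e.symm y) v) ∘ e) <| by
          filter_upwards [e.open_source.mem_nhds hx] with z hz
          simp [e.left_inv hz]
      exact DFunLike.congr_fun (h1.unique h2) z
    -- Translation along `v` fixes `r`, hence the metric. So the pulled-back metric is constant
    -- along this line; its derivative at `0` becomes the Lie derivative once the second derivative
    -- of `e` is symmetrised.
    have hline : HasDerivAt (fun s : ℝ => x + s • v) v 0 := by
      simpa using ((hasDerivAt_id (0 : ℝ)).smul_const v).const_add x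
    have hx0 : x + (0 : ℝ) • v = x := by simp
    have ha (z : Coord) : HasDerivAt (fun s : ℝ => fderiv ℝ e (x + s • v) z)
        (fderiv ℝ (fderiv ℝ e) x v z) 0 :=
      (he.hasFDerivAt_fderiv_apply hx z).comp_hasDerivAt_of_eq (0 : ℝ) hline hx0.symm
    have he0 : HasDerivAt (fun s : ℝ => e (x + s • v)) (fderiv ℝ e x v) 0 :=
      (he.differentiableAt hx).hasFDerivAt.comp_hasDerivAt_of_eq (0 : ℝ) hline hx0.symm
    have h1 := hasDerivAt_metric_curve (H := H) (D := D)
      (by simpa using differentiableAt_radii hU hH hr)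
      (by simpa using differentiableAt_radii hU hD hr) he0 (ha u) (ha w)
    have h2 : HasDerivAt (fun s : ℝ => metric H D (e (x + s • v)) (fderiv ℝ e (x + s • v) u)
        (fderiv ℝ e (x + s • v) w)) 0 0 := by
      refine (hasDerivAt_const (0 : ℝ) (metric H D x u w)).congr_of_eventuallyEq ?_
      have hc : Tendsto (fun s : ℝ => x + s • v) (𝓝 0) (𝓝 x) := by
        simpa using hline.continuousAt.tendsto
      filter_upwards [hc (e.open_source.mem_nhds hx)] with s hs
      rw [he.2.2.2.2 _ hs]
      simp [metric, hv]
    have h3 := h1.unique h2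
    simp only [hx0] at h3
    rw [lieDerivMetric_eq _ _ (differentiableAt_radii hU hH hr) (differentiableAt_radii hU hD hr),
      hDη, hDη, he.snd_fderiv_symm hx u, he.snd_fderiv_symm hx w]
    simpa [e.left_inv hx] using h3

end Isometry

/-- Comparison of the metric functions along two radial lines that are identified by an isometry
whose restriction to the `(t, φ)`-directions is constant, with columns `a` and `b`. -/
theorem quotients_eq_of_radial_isometry {J : Set ℝ} (hJ : IsOpen J)
    (hH : ContDiffOn ℝ ∞ H J) (hD : ContDiffOn ℝ ∞ D J) (hD0 : ∀ r ∈ J, D r ≠ 0)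
    {a0 a1 b0 b1 ε ρ σ δ : ℝ} (hε : ε ^ 2 = 1) (hδ : 0 < δ)
    (hρ : ∀ s ∈ Ioo (-δ) δ, ρ + ε * s ∈ J) (hσ : ∀ s ∈ Ioo (-δ) δ, σ + s ∈ J)
    (haa : ∀ s ∈ Ioo (-δ) δ, -(a0 + H (ρ + ε * s) * a1) ^ 2 + D (ρ + ε * s) ^ 2 * a1 ^ 2 = -1)
    (hab : ∀ s ∈ Ioo (-δ) δ, -((a0 + H (ρ + ε * s) * a1) * (b0 + H (ρ + ε * s) * b1))
      + D (ρ + ε * s) ^ 2 * (a1 * b1) = -H (σ + s))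
    (hbb : ∀ s ∈ Ioo (-δ) δ, -(b0 + H (ρ + ε * s) * b1) ^ 2 + D (ρ + ε * s) ^ 2 * b1 ^ 2
      = -H (σ + s) ^ 2 + D (σ + s) ^ 2) :
    (deriv H σ / D σ) ^ 2 = (deriv H ρ / D ρ) ^ 2 ∧
      deriv (deriv D) σ / D σ = deriv (deriv D) ρ / D ρ := by
  have h0 : (0 : ℝ) ∈ Ioo (-δ) δ := ⟨by linarith, hδ⟩
  have hρ0 : ρ ∈ J := by simpa using hρ 0 h0
  have hσ0 : σ ∈ J := by simpa using hσ 0 h0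
  have der {G : ℝ → ℝ} (hG : ContDiffOn ℝ ∞ G J) {r : ℝ} (hr : r ∈ J) :
      HasDerivAt G (deriv G r) r :=
    ((hG.contDiffAt (hJ.mem_nhds hr)).differentiableAt (by simp)).hasDerivAt
  have dρ {G : ℝ → ℝ} (hG : ContDiffOn ℝ ∞ G J) {s : ℝ} (hs : s ∈ Ioo (-δ) δ) :
      HasDerivAt (fun s => G (ρ + ε * s)) (deriv G (ρ + ε * s) * ε) s := by
    have h : HasDerivAt (fun s => ρ + ε * s) ε s := by
      simpa using ((hasDerivAt_id s).const_mul ε).const_add ρ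
    exact (der hG (hρ s hs)).comp s h
  have dσ {G : ℝ → ℝ} (hG : ContDiffOn ℝ ∞ G J) {s : ℝ} (hs : s ∈ Ioo (-δ) δ) :
      HasDerivAt (fun s => G (σ + s)) (deriv G (σ + s)) s := by
    have h : HasDerivAt (fun s => σ + s) 1 s := (hasDerivAt_id s).const_add σ
    exact ((der hG (hσ s hs)).comp s h).congr_deriv (mul_one _)
  have uniq {F G : ℝ → ℝ} {F' G' s : ℝ} (hs : s ∈ Ioo (-δ) δ)
      (hF : HasDerivAt F F' s) (hG : HasDerivAt G G' s) (h : EqOn F G (Ioo (-δ) δ)) : F' = G' :=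
    hF.unique (hG.congr_of_eventuallyEq (h.eventuallyEq_of_mem (isOpen_Ioo.mem_nhds hs)))
  have hD1 : ContDiffOn ℝ ∞ (deriv D) J := hD.deriv_of_isOpen hJ le_rfl
  set l := a0 * b1 - a1 * b0 with hl
  -- Determinants of the two Gram matrices, each equal to `-D²`; `l` is the determinant of the
  -- change of basis.
  have hdet : ∀ s ∈ Ioo (-δ) δ, D (ρ + ε * s) ^ 2 * l ^ 2 = D (σ + s) ^ 2 := by
    intro s hs
    have h1 := haa s hs
    have h2 := hab s hs
    have h3 := hbb s hs
    rw [hl]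
    linear_combination -(h1 * (-(b0 + H (ρ + ε * s) * b1) ^ 2 + D (ρ + ε * s) ^ 2 * b1 ^ 2) - h3
      - h2 * (-((a0 + H (ρ + ε * s) * a1) * (b0 + H (ρ + ε * s) * b1))
        + D (ρ + ε * s) ^ 2 * (a1 * b1) - H (σ + s)))
  have hdet1 : ∀ s ∈ Ioo (-δ) δ, ε * (D (ρ + ε * s) * deriv D (ρ + ε * s)) * l ^ 2
      = D (σ + s) * deriv D (σ + s) := by
    intro s hs
    have := uniq hs (((dρ hD hs).pow 2).mul_const (l ^ 2)) ((dσ hD hs).pow 2) hdet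
    simp at this
    linarith
  have hdet2 := uniq h0 ((((dρ hD h0).mul (dρ hD1 h0)).const_mul ε).mul_const (l ^ 2))
    ((dσ hD h0).mul (dσ hD1 h0)) hdet1
  have hA := uniq h0 ((((((dρ hH h0).mul_const a1).const_add a0).pow 2).neg).add
    (((dρ hD h0).pow 2).mul_const (a1 ^ 2))) (hasDerivAt_const 0 (-1)) haa
  have hB := uniq h0 (((((dρ hH h0).mul_const a1).const_add a0).mul
    (((dρ hH h0).mul_const b1).const_add b0)).neg.add
    (((dρ hD h0).pow 2).mul_const (a1 * b1))) (dσ hH h0).neg hab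
  have e0 := hdet 0 h0
  have e1 := hdet1 0 h0
  simp only [mul_zero, add_zero, Nat.cast_ofNat, Nat.reduceSub, pow_one] at hA hB hdet2 e0 e1
  have hDρ := hD0 ρ hρ0
  have hDσ := hD0 σ hσ0
  generalize deriv (deriv D) ρ = D2ρ, deriv (deriv D) σ = D2σ at *
  generalize deriv D ρ = D1ρ, deriv D σ = D1σ, deriv H ρ = H1ρ, deriv H σ = H1σ at *
  -- Determinants of the differentiated Gram matrices: the `tt` entry is constant, so each is
  -- `-H'²`, and only the `tt` and `tφ` relations are needed.
  have hHl : H1σ ^ 2 = H1ρ ^ 2 * l ^ 2 := by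
    have hK : H1σ ^ 2 - (H1ρ * ε) ^ 2 * l ^ 2 = 0 := by
      set K := -2 * H ρ * (H1ρ * ε) + 2 * D ρ * (D1ρ * ε)
      have hA' : a1 * (-2 * a0 * (H1ρ * ε) + a1 * K) = 0 := by linear_combination hA
      have hB' : -(H1ρ * ε) * (a0 * b1 + a1 * b0) + a1 * b1 * K = -H1σ := by
        linear_combination hB
      rw [hl]
      linear_combination (-(-(H1ρ * ε) * (a0 * b1 + a1 * b0) + a1 * b1 * K) + H1σ) * hB'
        + b1 * (-2 * (H1ρ * ε) * b0 + b1 * K) * hA'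
    linear_combination hK + H1ρ ^ 2 * l ^ 2 * hε
  have hDl : D1ρ ^ 2 * l ^ 2 = D1σ ^ 2 := by
    refine mul_left_cancel₀ (pow_ne_zero 2 hDσ) ?_
    linear_combination (ε * (D ρ * D1ρ) * l ^ 2 + D σ * D1σ) * e1 - D1ρ ^ 2 * l ^ 2 * e0
      - (D ρ * D1ρ * l ^ 2) ^ 2 * hε
  constructor
  · rw [div_pow, div_pow, div_eq_div_iff (pow_ne_zero 2 hDσ) (pow_ne_zero 2 hDρ)]
    linear_combination D ρ ^ 2 * hHl + H1ρ ^ 2 * e0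
  · rw [div_eq_div_iff hDσ hDρ]
    refine mul_left_cancel₀ hDσ ?_
    linear_combination -D ρ * hdet2 + D2ρ * e0 + D ρ * hDl
      + D ρ * (D1ρ ^ 2 + D ρ * D2ρ) * l ^ 2 * hε

end GodelType

/-! ### Local homogeneity forces constant quotients. -/

namespace GodelType

open Set Filter Topology

variable {H D : ℝ → ℝ} {U : Set Coord}

/-- A linear isometry between tangent spaces that preserves the span of `∂_t` and `∂_φ` maps
`∂_r` to `± ∂_r`. -/
theorem radial_of_metric_preserving {y x a b c : Coord} (hD : D (x 2) ≠ 0)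
    (ha : a 2 = 0) (hb : b 2 = 0)
    (haa : metric H D y a a = metric H D x (Pi.single 0 1) (Pi.single 0 1))
    (hab : metric H D y a b = metric H D x (Pi.single 0 1) (Pi.single 1 1))
    (hbb : metric H D y b b = metric H D x (Pi.single 1 1) (Pi.single 1 1))
    (hac : metric H D y a c = metric H D x (Pi.single 0 1) (Pi.single 2 1))
    (hbc : metric H D y b c = metric H D x (Pi.single 1 1) (Pi.single 2 1))
    (hcc : metric H D y c c = metric H D x (Pi.single 2 1) (Pi.single 2 1)) :
    c 0 = 0 ∧ c 1 = 0 ∧ c 2 ^ 2 = 1 := by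
  simp [metric, ha, hb] at haa hab hbb hac hbc hcc
  have hdet : D (y 2) ^ 2 * (a 0 * b 1 - a 1 * b 0) ^ 2 = D (x 2) ^ 2 := by
    linear_combination -(haa * (-((b 0 + H (y 2) * b 1) * (b 0 + H (y 2) * b 1))
      + D (y 2) ^ 2 * (b 1 * b 1)) - hbb
      - hab * (-((a 0 + H (y 2) * a 1) * (b 0 + H (y 2) * b 1))
        + D (y 2) ^ 2 * (a 1 * b 1) - H (x 2)))
  have hne : D (y 2) ^ 2 * (a 0 * b 1 - a 1 * b 0) ^ 2 ≠ 0 := hdet ▸ pow_ne_zero 2 hD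
  have hDy : D (y 2) ≠ 0 := by rintro h; simp [h] at hne
  have hl : a 0 * b 1 - a 1 * b 0 ≠ 0 := by rintro h; simp [h] at hne
  -- `c` is orthogonal to `a` and `b`, which span the `(t, φ)`-plane because their determinant is
  -- nonzero.
  have hκ : c 0 + H (y 2) * c 1 = 0 := by
    refine (mul_eq_zero.1 (?_ : (a 0 * b 1 - a 1 * b 0) * (c 0 + H (y 2) * c 1) = 0)).resolve_left
      hl
    linear_combination -b 1 * hac + a 1 * hbc
  have hc1 : c 1 = 0 := by
    refine (mul_eq_zero.1 (?_ : D (y 2) ^ 2 * (a 0 * b 1 - a 1 * b 0) * c 1 = 0)).resolve_left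
      (mul_ne_zero (pow_ne_zero 2 hDy) hl)
    linear_combination -b 0 * hac + a 0 * hbc + (a 0 * (b 0 + H (y 2) * b 1)
      - b 0 * (a 0 + H (y 2) * a 1)) * hκ
  have hc0 : c 0 = 0 := by simpa [hc1] using hκ
  refine ⟨hc0, hc1, ?_⟩
  simpa [hc0, hc1, pow_two] using hcc

/-- Along a radial line, an isometry that preserves the `(t, φ)`-directions has constant
differential. -/
theorem IsLocalIsometry.quotients_eq {e : OpenPartialHomeomorph Coord Coord} (hU : IsOpen U)
    (hH : ContDiffOn ℝ ∞ H (radii U)) (hD : ContDiffOn ℝ ∞ D (radii U))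
    (hD0 : ∀ r ∈ radii U, D r ≠ 0) (he : IsLocalIsometry H D U e) {S : Set Coord}
    (hS : IsOpen S) (hSe : S ⊆ e.source)
    (h : ∀ x ∈ S, ∀ v : Coord, v 2 = 0 → fderiv ℝ e x v 2 = 0) {p : Coord} (hp : p ∈ S) :
    (deriv H (p 2) / D (p 2)) ^ 2 = (deriv H (e p 2) / D (e p 2)) ^ 2 ∧
      deriv (deriv D) (p 2) / D (p 2) = deriv (deriv D) (e p 2) / D (e p 2) := by
  have hm := he.2.2.2.2
  have hc : ∀ x ∈ S, fderiv ℝ e x (Pi.single 2 1) 0 = 0 ∧ fderiv ℝ e x (Pi.single 2 1) 1 = 0 ∧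
      fderiv ℝ e x (Pi.single 2 1) 2 ^ 2 = 1 := fun x hx =>
    have hxs := hSe hx
    radial_of_metric_preserving (hD0 _ (mem_radii (he.1 hxs)))
      (h x hx _ (by simp)) (h x hx _ (by simp)) (hm x hxs _ _) (hm x hxs _ _)
      (hm x hxs _ _) (hm x hxs _ _) (hm x hxs _ _) (hm x hxs _ _)
  -- The image of `∂_r` is locally constant: two components vanish and the third has square `1`. By
  -- symmetry of the second derivative, `de` is then constant along radial lines.
  have hcd : ∀ x ∈ S, ∀ v, fderiv ℝ (fderiv ℝ e) x v (Pi.single 2 1) = 0 := by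
    intro x hx v
    have h1 := he.hasFDerivAt_fderiv_apply (hSe hx) (Pi.single 2 1)
    have h2 := hasFDerivAt_pi'.1 h1
    have hS' := hS.mem_nhds hx
    have z (i : Fin 3) (hi : ∀ x ∈ S, fderiv ℝ e x (Pi.single 2 1) i = 0) :
        fderiv ℝ (fderiv ℝ e) x v (Pi.single 2 1) i = 0 := by
      have h3 := (hasFDerivAt_const (𝕜 := ℝ) (0 : ℝ) x).congr_of_eventuallyEq
        (f₁ := fun z => fderiv ℝ e z (Pi.single 2 1) i)
        (by filter_upwards [hS'] with z hz using hi z hz)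
      simpa using DFunLike.congr_fun ((h2 i).unique h3) v
    ext i
    fin_cases i
    · exact z 0 fun x hx => (hc x hx).1
    · exact z 1 fun x hx => (hc x hx).2.1
    · have h3 := (hasFDerivAt_const (𝕜 := ℝ) (1 : ℝ) x).congr_of_eventuallyEq
        (f₁ := fun z => fderiv ℝ e z (Pi.single 2 1) 2 ^ 2)
        (by filter_upwards [hS'] with z hz using (hc z hz).2.2)
      have h4 := DFunLike.congr_fun (((h2 2).pow 2).unique h3) v
      have h5 : fderiv ℝ e x (Pi.single 2 1) 2 ≠ 0 := by
        intro h0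
        have := (hc x hx).2.2
        simp [h0] at this
      simpa [h5] using h4
  obtain ⟨δ, hδ, hball⟩ := Metric.isOpen_iff.1 hS p hp
  have hline (s : ℝ) : HasDerivAt (fun s : ℝ => p + s • (Pi.single 2 1 : Coord))
      (Pi.single 2 1) s := by
    simpa using ((hasDerivAt_id s).smul_const (Pi.single 2 1 : Coord)).const_add p
  have hmem : ∀ s ∈ Ioo (-δ) δ, p + s • (Pi.single 2 1 : Coord) ∈ S := by
    intro s hs
    refine hball ?_
    simp [dist_eq_norm, norm_smul, Pi.norm_single, abs_lt, hs.1, hs.2]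
  have h0 : (0 : ℝ) ∈ Ioo (-δ) δ := ⟨by linarith, hδ⟩
  have hp0 : p + (0 : ℝ) • (Pi.single 2 1 : Coord) = p := by simp
  have hconst {F : ℝ → Coord} (hF : ∀ s ∈ Ioo (-δ) δ, HasDerivAt F 0 s) :
      ∀ s ∈ Ioo (-δ) δ, F s = F 0 := fun s hs =>
    isOpen_Ioo.is_const_of_deriv_eq_zero isPreconnected_Ioo
      (fun s hs => (hF s hs).differentiableAt.differentiableWithinAt)
      (fun s hs => (hF s hs).deriv) hs h0
  have hDe (v : Coord) : ∀ s ∈ Ioo (-δ) δ,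
      fderiv ℝ e (p + s • (Pi.single 2 1 : Coord)) v = fderiv ℝ e p v := by
    intro s hs
    have := hconst (F := fun s => fderiv ℝ e (p + s • (Pi.single 2 1 : Coord)) v)
      (fun s hs => by
        have := (he.hasFDerivAt_fderiv_apply (hSe (hmem s hs)) v).comp_hasDerivAt s (hline s)
        exact this.congr_deriv (by
          simp [he.snd_fderiv_symm (hSe (hmem s hs)) _ v, hcd _ (hmem s hs)])) s hs
    simpa using this
  set c := fderiv ℝ e p (Pi.single 2 1) with hcdef
  have hes : ∀ s ∈ Ioo (-δ) δ, e (p + s • (Pi.single 2 1 : Coord)) = e p + s • c := by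
    intro s hs
    have := hconst (F := fun s => e (p + s • (Pi.single 2 1 : Coord)) - s • c)
      (fun s hs => (((he.differentiableAt (hSe (hmem s hs))).hasFDerivAt.comp_hasDerivAt s
        (hline s)).sub ((hasDerivAt_id s).smul_const c)).congr_deriv (by
          simp [hDe _ s hs, c])) s hs
    simp only [zero_smul, add_zero, sub_zero] at this
    rw [← this, sub_add_cancel]
  have hr : ∀ s ∈ Ioo (-δ) δ, e (p + s • (Pi.single 2 1 : Coord)) 2 = e p 2 + c 2 * s := by
    intro s hs
    rw [hes s hs]
    simp [mul_comm]
  have ha2 := h p hp (Pi.single 0 1) (by simp)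
  have hb2 := h p hp (Pi.single 1 1) (by simp)
  have key (u v : Coord) : ∀ s ∈ Ioo (-δ) δ,
      metric H D (e (p + s • (Pi.single 2 1 : Coord))) (fderiv ℝ e p u) (fderiv ℝ e p v) =
        metric H D (p + s • (Pi.single 2 1 : Coord)) u v := by
    intro s hs
    have := hm _ (hSe (hmem s hs)) u v
    rwa [hDe u s hs, hDe v s hs] at this
  refine quotients_eq_of_radial_isometry (isOpen_radii hU) hH hD hD0
    (a0 := fderiv ℝ e p (Pi.single 0 1) 0) (a1 := fderiv ℝ e p (Pi.single 0 1) 1)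
    (b0 := fderiv ℝ e p (Pi.single 1 1) 0) (b1 := fderiv ℝ e p (Pi.single 1 1) 1)
    (ε := c 2) (hc p hp).2.2 hδ ?_ ?_ ?_ ?_ ?_
  · intro s hs
    rw [← hr s hs]
    exact mem_radii (he.2.1 (e.map_source (hSe (hmem s hs))))
  · intro s hs
    simpa using mem_radii (he.1 (hSe (hmem s hs)))
  · intro s hs
    have := key (Pi.single 0 1) (Pi.single 0 1) s hs
    simp [metric, hr s hs, ha2] at this
    linear_combination this
  · intro s hs
    have := key (Pi.single 0 1) (Pi.single 1 1) s hs
    simp [metric, hr s hs, ha2] at this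
    linear_combination this
  · intro s hs
    have := key (Pi.single 1 1) (Pi.single 1 1) s hs
    simp [metric, hr s hs, hb2] at this
    linear_combination this

theorem LocallyHomogeneous.constantParameters (hU : IsOpen U) (hUc : IsConnected U)
    (hH : ContDiffOn ℝ ∞ H (radii U)) (hD : ContDiffOn ℝ ∞ D (radii U))
    (hD0 : ∀ r ∈ radii U, D r ≠ 0) (h : LocallyHomogeneous H D U) :
    ConstantParameters H D U := by
  have hh := contDiffOn_quotient (contDiffOn_deriv_radii hU hH) hD hD0
  have hk := contDiffOn_quotient (contDiffOn_deriv_radii hU (contDiffOn_deriv_radii hU hD)) hD hD0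
  by_cases hz : ∀ r ∈ radii U, deriv (fun r => deriv H r / D r) r = 0 ∧
      deriv (fun r => deriv (deriv D) r / D r) r = 0
  · obtain ⟨p, hp⟩ := hUc.nonempty
    exact constantParameters_of_forall_eq
      (fun x hx => eq_of_deriv_eq_zero_on_radii hU hUc hh (fun r hr => (hz r hr).1)
        (mem_radii hx) (mem_radii hp))
      (fun x hx => eq_of_deriv_eq_zero_on_radii hU hUc hk (fun r hr => (hz r hr).2)
        (mem_radii hx) (mem_radii hp))
  push Not at hz
  obtain ⟨_, ⟨q, hq, rfl⟩, hzq⟩ := hz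
  have heq : ∀ p ∈ U, (deriv H (p 2) / D (p 2)) ^ 2 = (deriv H (q 2) / D (q 2)) ^ 2 ∧
      deriv (deriv D) (p 2) / D (p 2) = deriv (deriv D) (q 2) / D (q 2) := by
    intro p hp
    obtain ⟨e, he, hpe, rfl⟩ := h p hp q hq
    set P : ℝ → Prop := fun r => deriv (fun r => deriv H r / D r) r ≠ 0 ∨
      deriv (fun r => deriv (deriv D) r / D r) r ≠ 0
    -- Nonvanishing of one of the derivatives persists nearby, so Killing fields have no radial
    -- component on a whole neighbourhood.
    have hnhds : ∀ᶠ r in 𝓝 (e p 2), P r := by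
      have hJ := (isOpen_radii hU).mem_nhds (mem_radii hq)
      have c1 := ((contDiffOn_deriv_radii hU hh).continuousOn.continuousAt hJ)
      have c2 := ((contDiffOn_deriv_radii hU hk).continuousOn.continuousAt hJ)
      by_cases h1 : deriv (fun r => deriv H r / D r) (e p 2) = 0
      · exact (c2.eventually_ne (hzq h1)).mono fun r hr => .inr hr
      · exact (c1.eventually_ne h1).mono fun r hr => .inl hr
    obtain ⟨W, hW, hWo, hqW⟩ := eventually_nhds_iff.1 hnhds
    refine he.quotients_eq hU hH hD hD0 (S := e.source ∩ e ⁻¹' {y | y 2 ∈ W})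
      (e.isOpen_inter_preimage (hWo.preimage (continuous_apply 2))) inter_subset_left ?_
      ⟨hpe, hqW⟩
    rintro x ⟨hx, hxW⟩ v hv
    by_contra hne
    have := deriv_parameters_eq_zero hU hH hD hD0 e.open_target he.2.1
      (he.isKillingOn_push hU hH hD hv) (e.map_source hx) (by simpa [e.left_inv hx] using hne)
    exact (hW _ hxW).elim (fun h => h this.1) (fun h => h this.2)
  refine constantParameters_of_forall_eq (p := q) (fun x hx => ?_) fun x hx => (heq x hx).2
  by_cases h0 : deriv H (q 2) / D (q 2) = 0
  · have := (heq x hx).1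
    rw [h0] at this ⊢
    simpa using this
  -- Only the square is known to be constant; where it is nonzero, differentiating it gives `(H'/D)'
  -- = 0`.
  refine eq_of_deriv_eq_zero_on_radii hU hUc hh ?_ (mem_radii hx) (mem_radii hq)
  rintro _ ⟨p, hp, rfl⟩
  have hJ := (isOpen_radii hU).mem_nhds (mem_radii hp)
  have hd := ((hh.contDiffAt hJ).differentiableAt (by simp)).hasDerivAt
  have hc := (hasDerivAt_const (p 2) ((deriv H (q 2) / D (q 2)) ^ 2)).congr_of_eventuallyEq
    (f₁ := fun r => (deriv H r / D r) ^ 2) (by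
      filter_upwards [hJ]
      rintro _ ⟨x, hx, rfl⟩
      exact (heq x hx).1)
  have h1 := (hd.fun_pow 2).unique hc
  have h2 : deriv H (p 2) / D (p 2) ≠ 0 := by
    intro h
    have := (heq p hp).1
    rw [h] at this
    exact h0 (by simpa using this.symm)
  simpa [h2, -div_eq_zero_iff] using h1

end GodelType

/-! ### Constant quotients give three-dimensional orbits. -/

namespace GodelType

open Set Filter Topology

/-- The solution `S` of `S'' = k S`, `S 0 = 0`, `S' 0 = 1`, together with its primitive `Q`. -/
structure IsGenSine (k : ℝ) (S Q : ℝ → ℝ) : Prop where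
  contDiff_sine : ContDiff ℝ ∞ S
  contDiff_versine : ContDiff ℝ ∞ Q
  hasDerivAt_sine : ∀ x, HasDerivAt S (1 + k * Q x) x
  hasDerivAt_versine : ∀ x, HasDerivAt Q (S x) x
  sine_zero : S 0 = 0
  versine_zero : Q 0 = 0

/-- A first integral, equivalent to `S'² - k S² = 1` when `k ≠ 0`. Stated with `Q`, it keeps its
content at `k = 0`. -/
theorem IsGenSine.sq {k : ℝ} {S Q : ℝ → ℝ} (h : IsGenSine k S Q) (x : ℝ) :
    S x ^ 2 = 2 * Q x + k * Q x ^ 2 := by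
  have hd (x : ℝ) : HasDerivAt (fun x => S x ^ 2 - 2 * Q x - k * Q x ^ 2) 0 x := by
    refine ((((h.hasDerivAt_sine x).fun_pow 2).sub ((h.hasDerivAt_versine x).const_mul 2)).sub
      (((h.hasDerivAt_versine x).fun_pow 2).const_mul k)).congr_deriv ?_
    simp
    ring
  have := is_const_of_deriv_eq_zero (fun x => (hd x).differentiableAt) (fun x => (hd x).deriv) x 0
  simp [h.sine_zero, h.versine_zero] at this
  linarith

theorem exists_isGenSine (k : ℝ) : ∃ S Q : ℝ → ℝ, IsGenSine k S Q := by
  rcases lt_trichotomy k 0 with hk | rfl | hk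
  · obtain ⟨m, hm, rfl⟩ : ∃ m : ℝ, m ≠ 0 ∧ k = -m ^ 2 :=
      ⟨√(-k), (Real.sqrt_pos.2 (by linarith)).ne', by rw [Real.sq_sqrt (by linarith)]; ring⟩
    have hmul (x : ℝ) : HasDerivAt (fun x => m * x) m x := by
      simpa using (hasDerivAt_id x).const_mul m
    refine ⟨fun x => Real.sin (m * x) / m, fun x => (1 - Real.cos (m * x)) / m ^ 2,
      by fun_prop, by fun_prop, fun x => ?_, fun x => ?_, by simp, by simp⟩
    · refine ((hmul x).sin.div_const m).congr_deriv ?_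
      field_simp
      ring
    · refine (((hmul x).cos.const_sub 1).div_const (m ^ 2)).congr_deriv ?_
      field_simp
  · refine ⟨fun x => x, fun x => x ^ 2 / 2, by fun_prop, by fun_prop, fun x => ?_, fun x => ?_,
      rfl, by simp⟩
    · simpa using hasDerivAt_id' x
    · refine (((hasDerivAt_id' x).fun_pow 2).div_const 2).congr_deriv ?_
      simp
  · obtain ⟨m, hm, rfl⟩ : ∃ m : ℝ, m ≠ 0 ∧ k = m ^ 2 :=
      ⟨√k, (Real.sqrt_pos.2 hk).ne', by rw [Real.sq_sqrt hk.le]⟩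
    have hmul (x : ℝ) : HasDerivAt (fun x => m * x) m x := by
      simpa using (hasDerivAt_id x).const_mul m
    refine ⟨fun x => Real.sinh (m * x) / m, fun x => (Real.cosh (m * x) - 1) / m ^ 2,
      by fun_prop, by fun_prop, fun x => ?_, fun x => ?_, by simp, by simp⟩
    · refine ((hmul x).sinh.div_const m).congr_deriv ?_
      field_simp
      ring
    · refine (((hmul x).cosh.sub_const 1).div_const (m ^ 2)).congr_deriv ?_
      field_simp

theorem hasFDerivAt_angular {g : ℝ → ℝ} {g' : ℝ} {x : Coord} (hg : HasDerivAt g g' (x 1)) :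
    HasFDerivAt (fun y : Coord => g (y 1)) (g' • ContinuousLinearMap.proj (R := ℝ) (1 : Fin 3)) x :=
  hg.comp_hasFDerivAt x (hasFDerivAt_apply 1 x)

theorem hasFDerivAt_radial_mul_angular {f g : ℝ → ℝ} {f' g' : ℝ} {x : Coord}
    (hf : HasDerivAt f f' (x 2)) (hg : HasDerivAt g g' (x 1)) :
    HasFDerivAt (fun y : Coord => f (y 2) * g (y 1))
      ((f (x 2) * g') • ContinuousLinearMap.proj (R := ℝ) (1 : Fin 3)
        + (f' * g (x 1)) • ContinuousLinearMap.proj (R := ℝ) (2 : Fin 3)) x := by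
  refine ((hasFDerivAt_radial hf).mul (hasFDerivAt_angular hg)).congr_fderiv ?_
  ext u
  simp
  ring

section Constant

variable {H D : ℝ → ℝ} {U : Set Coord} {vort msq : ℝ}

/-- The energy integral of `D'' = m² D`; minus its value is the constant governing the
`φ`-dependence of the extra Killing field. -/
theorem deriv_sq_sub_const (hU : IsOpen U) (hUc : IsConnected U)
    (hD : ContDiffOn ℝ ∞ D (radii U))
    (hk : ∀ r ∈ radii U, deriv (deriv D) r = msq * D r) {r s : ℝ} (hr : r ∈ radii U)
    (hs : s ∈ radii U) :
    deriv D r ^ 2 - msq * D r ^ 2 = deriv D s ^ 2 - msq * D s ^ 2 := by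
  have hD1 := contDiffOn_deriv_radii hU hD
  refine eq_of_deriv_eq_zero_on_radii hU hUc (F := fun r => deriv D r ^ 2 - msq * D r ^ 2)
    ((hD1.pow 2).sub (contDiffOn_const.mul (hD.pow 2))) (fun r hr => ?_) hr hs
  have h1 := (differentiableAt_radii hU hD1 hr).hasDerivAt
  have h0 := (differentiableAt_radii hU hD hr).hasDerivAt
  refine (((h1.fun_pow 2).sub ((h0.fun_pow 2).const_mul msq)).congr_deriv ?_).deriv
  simp [hk r hr]
  ring

theorem isKillingOn_const {v : Coord} (hU : IsOpen U) (hH : ContDiffOn ℝ ∞ H (radii U))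
    (hD : ContDiffOn ℝ ∞ D (radii U)) (hv : v 2 = 0) : IsKillingOn H D U (fun _ => v) := by
  refine ⟨contDiffOn_const, fun x hx u w => ?_⟩
  rw [lieDerivMetric_eq _ _ (differentiableAt_radii hU hH (mem_radii hx))
    (differentiableAt_radii hU hD (mem_radii hx))]
  simp [hv, metric]

/-- When `H' / D` and `D'' / D` are constant there is a Killing vector field equal to `∂_r` at any
prescribed point. -/
theorem exists_killing_radial (hU : IsOpen U) (hUc : IsConnected U)
    (hH : ContDiffOn ℝ ∞ H (radii U)) (hD : ContDiffOn ℝ ∞ D (radii U))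
    (hD0 : ∀ r ∈ radii U, D r ≠ 0) (hh : ∀ r ∈ radii U, deriv H r = 2 * vort * D r)
    (hk : ∀ r ∈ radii U, deriv (deriv D) r = msq * D r) {p : Coord} (hp : p ∈ U) :
    ∃ ξ : Coord → Coord, IsKillingOn H D U ξ ∧ ξ p = Pi.single 2 1 := by
  set κ := deriv D (p 2) ^ 2 - msq * D (p 2) ^ 2 with hκ
  obtain ⟨S, Q, hS⟩ := exists_isGenSine (-κ)
  have hD1 := contDiffOn_deriv_radii hU hD
  have hq := contDiffOn_quotient hD1 hD hD0
  -- Ansatz: independent of `t`, with radial component `S'(φ - φ₀)`. The `φφ` equation forces `g =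
  -- -D'/D`, the `tφ` equation forces `f`, and the `rφ` equation becomes `S'' = -κ S`.
  let f : ℝ → ℝ := fun r => H r * (deriv D r / D r) - 2 * vort * D r
  let g : ℝ → ℝ := fun r => -(deriv D r / D r)
  have hf : ContDiffOn ℝ ∞ f (radii U) := (hH.mul hq).sub (contDiffOn_const.mul hD)
  have hg : ContDiffOn ℝ ∞ g (radii U) := hq.neg
  have hang {G : ℝ → ℝ} (hG : ContDiff ℝ ∞ G) :
      ContDiffOn ℝ ∞ (fun x : Coord => G (x 1 - p 1)) U :=
    (hG.comp ((contDiff_apply ℝ ℝ (1 : Fin 3)).sub contDiff_const)).contDiffOn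
  refine ⟨fun x => ![f (x 2) * S (x 1 - p 1), g (x 2) * S (x 1 - p 1),
    1 * (1 + -κ * Q (x 1 - p 1))], ⟨?_, fun x hx u w => ?_⟩, ?_⟩
  · refine contDiffOn_pi.2 fun i => ?_
    fin_cases i
    · exact (contDiffOn_radial hf subset_rfl).mul (hang hS.contDiff_sine)
    · exact (contDiffOn_radial hg subset_rfl).mul (hang hS.contDiff_sine)
    · exact contDiffOn_const.mul
        (contDiffOn_const.add (contDiffOn_const.mul (hang hS.contDiff_versine)))
  · have hr := mem_radii hx
    have hκx : deriv D (x 2) ^ 2 - msq * D (x 2) ^ 2 = κ :=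
      deriv_sq_sub_const hU hUc hD hk hr (mem_radii hp)
    have hDx := hD0 _ hr
    have dH := (differentiableAt_radii hU hH hr).hasDerivAt
    have dD := (differentiableAt_radii hU hD hr).hasDerivAt
    have dD1 := (differentiableAt_radii hU hD1 hr).hasDerivAt
    have dq := dD1.div dD hDx
    have df : HasDerivAt f (-(H (x 2) * κ / D (x 2) ^ 2)) (x 2) := by
      refine ((dH.mul dq).sub (dD.const_mul (2 * vort))).congr_deriv ?_
      rw [hh _ hr, hk _ hr, ← hκx]
      simp
      field_simp
      ring
    have dg : HasDerivAt g (κ / D (x 2) ^ 2) (x 2) := by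
      refine dq.neg.congr_deriv ?_
      rw [hk _ hr, ← hκx]
      field_simp
      ring
    have dS : HasDerivAt (fun φ => S (φ - p 1)) (1 + -κ * Q (x 1 - p 1)) (x 1) := by
      have := (hS.hasDerivAt_sine _).comp (x 1) ((hasDerivAt_id (x 1)).sub_const (p 1))
      exact this.congr_deriv (by simp)
    have dQ : HasDerivAt (fun φ => 1 + -κ * Q (φ - p 1)) (-κ * S (x 1 - p 1)) (x 1) := by
      have := (hS.hasDerivAt_versine _).comp (x 1) ((hasDerivAt_id (x 1)).sub_const (p 1))
      simpa using (this.const_mul (-κ)).const_add 1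
    have e0 := hasFDerivAt_radial_mul_angular df dS
    have e1 := hasFDerivAt_radial_mul_angular dg dS
    have e2 := hasFDerivAt_radial_mul_angular (hasDerivAt_const (x 2) (1 : ℝ)) dQ
    have hξ := (hasFDerivAt_pi (𝕜 := ℝ) (x := x)
      (φ := fun i x => (![f (x 2) * S (x 1 - p 1), g (x 2) * S (x 1 - p 1),
        1 * (1 + -κ * Q (x 1 - p 1))] : Coord) i)
      (φ' := ![_, _, _])).2 (by
        intro i
        fin_cases i
        exacts [e0, e1, e2])
    rw [lieDerivMetric_eq _ _ dH.differentiableAt dD.differentiableAt, hξ.fderiv]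
    simp [metric, f, g, hh _ hr]
    field_simp
    ring
  · ext i
    fin_cases i <;> simp [hS.sine_zero, hS.versine_zero]

theorem ConstantParameters.hasThreeDimOrbits (hU : IsOpen U) (hUc : IsConnected U)
    (hH : ContDiffOn ℝ ∞ H (radii U)) (hD : ContDiffOn ℝ ∞ D (radii U))
    (hD0 : ∀ r ∈ radii U, D r ≠ 0) (h : ConstantParameters H D U) : HasThreeDimOrbits H D U := by
  obtain ⟨vort, msq, h⟩ := h
  intro p hp
  have mem {ξ : Coord → Coord} (hξ : IsKillingOn H D U ξ) : ξ p ∈ orbitTangent H D U p :=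
    Submodule.subset_span ⟨U, hU, hp, subset_rfl, ξ, hξ, rfl⟩
  have htop : orbitTangent H D U p = ⊤ := by
    rw [eq_top_iff, ← (Pi.basisFun ℝ (Fin 3)).span_eq, Submodule.span_le]
    rintro _ ⟨i, rfl⟩
    rw [Pi.basisFun_apply]
    fin_cases i
    · exact mem (isKillingOn_const hU hH hD (v := Pi.single 0 1) (by simp))
    · exact mem (isKillingOn_const hU hH hD (v := Pi.single 1 1) (by simp))
    · obtain ⟨ξ, hξ, hξp⟩ := exists_killing_radial hU hUc hH hD hD0
        (fun r hr => (div_eq_iff (hD0 r hr)).1 (h r hr).1)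
        (fun r hr => (div_eq_iff (hD0 r hr)).1 (h r hr).2) hp
      exact hξp ▸ mem hξ
  rw [htop]
  simp

end Constant

end GodelType

/-! ### The model metric and coordinates bringing the metric to it. -/

namespace GodelType

open Set Filter Topology

/-- The Gödel-type metric with parameters `ω` and `m²` in coordinates `(τ, f₁, f₂)` in which the
metric on the quotient surface has inverse `δ + m² f fᵀ`. -/
noncomputable def modelMetric (vort msq : ℝ) (y u v : Coord) : ℝ :=
  -((u 0 + 2 * vort * (y 1 * u 2 - y 2 * u 1) / (1 + √(1 + msq * (y 1 ^ 2 + y 2 ^ 2))))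
      * (v 0 + 2 * vort * (y 1 * v 2 - y 2 * v 1) / (1 + √(1 + msq * (y 1 ^ 2 + y 2 ^ 2)))))
    + (u 1 * v 1 + u 2 * v 2)
    - msq * ((y 1 * u 1 + y 2 * u 2) * (y 1 * v 1 + y 2 * v 2))
        / (1 + msq * (y 1 ^ 2 + y 2 ^ 2))

/-- Algebraic relations between the functions `f₁`, `f₂` defining the model coordinates, their
partial derivatives, and the functions `w = √(1 + m² (f₁² + f₂²))` and `N = ∂_r w / m²`. -/
theorem model_coordinate_relations {S c Q C D0 E0 k D D1 N w f1 f2 f1r f1p f2r f2p : ℝ}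
    (hD : D = D0 * c + E0 * S) (hD1 : D1 = k * D0 * S + E0 * c)
    (hc : c ^ 2 = 1 + k * S ^ 2) (hC : C ^ 2 = 2 * Q - (E0 ^ 2 - k * D0 ^ 2) * Q ^ 2)
    (hf1 : f1 = S - E0 * (D * Q)) (hf2 : f2 = D * C) (hw : w = c + k * D0 * (D * Q))
    (hN : N = S + D0 * (D1 * Q)) (h1r : f1r = c - E0 * (D1 * Q)) (h1p : f1p = -(E0 * (D * C)))
    (h2r : f2r = D1 * C) (h2p : f2p = D * (1 - (E0 ^ 2 - k * D0 ^ 2) * Q)) :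
    (w ^ 2 = 1 + k * (f1 ^ 2 + f2 ^ 2) ∧ w ^ 2 - 1 = k * (N ^ 2 + D0 ^ 2 * C ^ 2)) ∧
    (f1 * f2p - f2 * f1p = D * N ∧ f1 * f2r - f2 * f1r = -(D0 * C)) ∧
    (f1 * f1r + f2 * f2r = w * N ∧ f1 * f1p + f2 * f2p = w * (D0 * D * C)) ∧
    (f1r ^ 2 + f2r ^ 2 = 1 + k * N ^ 2 ∧ f1p ^ 2 + f2p ^ 2 = D ^ 2 + k * (D0 * D * C) ^ 2 ∧
      f1r * f1p + f2r * f2p = k * N * (D0 * D * C)) ∧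
    D * w - D1 * N = D0 * (1 - (E0 ^ 2 - k * D0 ^ 2) * Q) := by
  subst_vars
  refine ⟨⟨?_, ?_⟩, ⟨?_, ?_⟩, ⟨?_, ?_⟩, ⟨?_, ?_, ?_⟩, ?_⟩ <;> grind

/-- Pointwise pullback. The time coordinate absorbs exactly the difference between `dt + H dφ` and
the model 1-form, and the relations for `f₁`, `f₂` identify the surface metrics. -/
theorem modelMetric_eq_metric {H D : ℝ → ℝ} {vort k D0 C N w f1r f1p f2r f2p : ℝ}
    {x u v y a b : Coord}
    (hw : 0 < w) (hwsq : w ^ 2 = 1 + k * (y 1 ^ 2 + y 2 ^ 2))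
    (hp : y 1 * f2p - y 2 * f1p = D (x 2) * N) (hr : y 1 * f2r - y 2 * f1r = -(D0 * C))
    (hyr : y 1 * f1r + y 2 * f2r = w * N) (hyp : y 1 * f1p + y 2 * f2p = w * (D0 * D (x 2) * C))
    (hrr : f1r ^ 2 + f2r ^ 2 = 1 + k * N ^ 2)
    (hpp : f1p ^ 2 + f2p ^ 2 = D (x 2) ^ 2 + k * (D0 * D (x 2) * C) ^ 2)
    (hrp : f1r * f1p + f2r * f2p = k * N * (D0 * D (x 2) * C))
    (ha0 : a 0 = u 0 + (H (x 2) - 2 * vort * (D (x 2) * N * (1 + w)⁻¹)) * u 1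
      + 2 * vort * D0 * (C * (1 + w)⁻¹) * u 2)
    (ha1 : a 1 = f1p * u 1 + f1r * u 2) (ha2 : a 2 = f2p * u 1 + f2r * u 2)
    (hb0 : b 0 = v 0 + (H (x 2) - 2 * vort * (D (x 2) * N * (1 + w)⁻¹)) * v 1
      + 2 * vort * D0 * (C * (1 + w)⁻¹) * v 2)
    (hb1 : b 1 = f1p * v 1 + f1r * v 2) (hb2 : b 2 = f2p * v 1 + f2r * v 2) :
    modelMetric vort k y a b = metric H D x u v := by
  have hsqrt : √(1 + k * (y 1 ^ 2 + y 2 ^ 2)) = w := by rw [← hwsq, Real.sqrt_sq hw.le]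
  have h1w : 1 + w ≠ 0 := by positivity
  have t1 : a 0 + 2 * vort * (y 1 * a 2 - y 2 * a 1) / (1 + w) = u 0 + H (x 2) * u 1 := by
    have : y 1 * a 2 - y 2 * a 1 = D (x 2) * N * u 1 - D0 * C * u 2 := by
      rw [ha1, ha2]; linear_combination u 1 * hp + u 2 * hr
    rw [this, ha0]
    field_simp
    ring
  have t2 : b 0 + 2 * vort * (y 1 * b 2 - y 2 * b 1) / (1 + w) = v 0 + H (x 2) * v 1 := by
    have : y 1 * b 2 - y 2 * b 1 = D (x 2) * N * v 1 - D0 * C * v 2 := by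
      rw [hb1, hb2]; linear_combination v 1 * hp + v 2 * hr
    rw [this, hb0]
    field_simp
    ring
  have s1 : y 1 * a 1 + y 2 * a 2 = w * (D0 * D (x 2) * C * u 1 + N * u 2) := by
    rw [ha1, ha2]; linear_combination u 1 * hyp + u 2 * hyr
  have s2 : y 1 * b 1 + y 2 * b 2 = w * (D0 * D (x 2) * C * v 1 + N * v 2) := by
    rw [hb1, hb2]; linear_combination v 1 * hyp + v 2 * hyr
  rw [modelMetric, hsqrt, t1, t2, s1, s2, ← hwsq, metric, ha1, ha2, hb1, hb2]
  field_simp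
  linear_combination u 1 * v 1 * hpp + u 2 * v 2 * hrr + (u 1 * v 2 + u 2 * v 1) * hrp

section Constant

variable {H D : ℝ → ℝ} {U : Set Coord} {vort msq : ℝ}

/-- A solution of `D'' = m² D` in terms of its initial values. -/
theorem eq_of_second_order_ode (hU : IsOpen U) (hUc : IsConnected U)
    (hD : ContDiffOn ℝ ∞ D (radii U))
    (hk : ∀ r ∈ radii U, deriv (deriv D) r = msq * D r) {S Q : ℝ → ℝ} (hS : IsGenSine msq S Q)
    {r ρ : ℝ} (hr : r ∈ radii U) (hρ : ρ ∈ radii U) :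
    D r = D ρ * (1 + msq * Q (r - ρ)) + deriv D ρ * S (r - ρ) ∧
      deriv D r = msq * D ρ * S (r - ρ) + deriv D ρ * (1 + msq * Q (r - ρ)) := by
  have hD1 := contDiffOn_deriv_radii hU hD
  have sS : ContDiff ℝ ∞ (fun r => S (r - ρ)) :=
    hS.contDiff_sine.comp (contDiff_id.sub contDiff_const)
  have sc : ContDiff ℝ ∞ (fun r => 1 + msq * Q (r - ρ)) :=
    contDiff_const.add (contDiff_const.mul
      (hS.contDiff_versine.comp (contDiff_id.sub contDiff_const)))
  have dS (r : ℝ) : HasDerivAt (fun r => S (r - ρ)) (1 + msq * Q (r - ρ)) r :=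
    ((hS.hasDerivAt_sine _).comp r ((hasDerivAt_id r).sub_const ρ)).congr_deriv (by simp)
  have dc (r : ℝ) : HasDerivAt (fun r => 1 + msq * Q (r - ρ)) (msq * S (r - ρ)) r :=
    ((((hS.hasDerivAt_versine _).comp r ((hasDerivAt_id r).sub_const ρ)).const_mul
      msq).const_add 1).congr_deriv (by simp)
  have d0 {r : ℝ} (hr : r ∈ radii U) := (differentiableAt_radii hU hD hr).hasDerivAt
  have d1 {r : ℝ} (hr : r ∈ radii U) : HasDerivAt (deriv D) (msq * D r) r :=
    hk r hr ▸ (differentiableAt_radii hU hD1 hr).hasDerivAt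
  -- The Wronskians of `D` with `S` and with `S'` are constant; solving for `D` and `D'` uses `S'² -
  -- m² S² = 1`.
  have w1 := eq_of_deriv_eq_zero_on_radii hU hUc
    (F := fun r => D r * (1 + msq * Q (r - ρ)) - deriv D r * S (r - ρ))
    ((hD.mul sc.contDiffOn).sub (hD1.mul sS.contDiffOn))
    (fun r hr => ((((d0 hr).mul (dc r)).sub ((d1 hr).mul (dS r))).congr_deriv (by ring)).deriv)
    hr hρ
  have w2 := eq_of_deriv_eq_zero_on_radii hU hUc
    (F := fun r => deriv D r * (1 + msq * Q (r - ρ)) - msq * (D r * S (r - ρ)))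
    ((hD1.mul sc.contDiffOn).sub (contDiffOn_const.mul (hD.mul sS.contDiffOn)))
    (fun r hr => ((((d1 hr).mul (dc r)).sub (((d0 hr).mul (dS r)).const_mul msq)).congr_deriv
      (by ring)).deriv)
    hr hρ
  simp only [sub_self, hS.sine_zero, hS.versine_zero, mul_zero, add_zero, mul_one, sub_zero]
    at w1 w2
  have hsq := hS.sq (r - ρ)
  constructor
  · linear_combination (1 + msq * Q (r - ρ)) * w1 + S (r - ρ) * w2 + msq * D r * hsq
  · linear_combination msq * S (r - ρ) * w1 + (1 + msq * Q (r - ρ)) * w2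
      + msq * deriv D r * hsq

end Constant

end GodelType

namespace GodelType

open Set Filter Topology

/-- Poincaré lemma for the one-forms `dt + A dφ + B dr` with `A` and `B` independent of `t`. -/
theorem exists_primitive {V : Set Coord} (hV : IsOpen V) (hVc : Convex ℝ V) {A B : Coord → ℝ}
    (sA : ContDiffOn ℝ ∞ A V) (sB : ContDiffOn ℝ ∞ B V)
    (h : ∀ x ∈ V, ∃ α β γ : ℝ,
      HasFDerivAt A (α • ContinuousLinearMap.proj (R := ℝ) (1 : Fin 3)
        + β • ContinuousLinearMap.proj (R := ℝ) (2 : Fin 3)) x ∧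
      HasFDerivAt B (β • ContinuousLinearMap.proj (R := ℝ) (1 : Fin 3)
        + γ • ContinuousLinearMap.proj (R := ℝ) (2 : Fin 3)) x) :
    ∃ τ : Coord → ℝ, ContDiffOn ℝ ∞ τ V ∧
      ∀ x ∈ V, HasFDerivAt τ (ContinuousLinearMap.proj (R := ℝ) (0 : Fin 3)
        + A x • ContinuousLinearMap.proj (R := ℝ) (1 : Fin 3)
        + B x • ContinuousLinearMap.proj (R := ℝ) (2 : Fin 3)) x := by
  set Ω : Coord → Coord →L[ℝ] ℝ := fun x => ContinuousLinearMap.proj (R := ℝ) (0 : Fin 3)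
        + A x • ContinuousLinearMap.proj (R := ℝ) (1 : Fin 3)
        + B x • ContinuousLinearMap.proj (R := ℝ) (2 : Fin 3) with hΩ
  have sΩ : ContDiffOn ℝ ∞ Ω V :=
    (contDiffOn_const.add (sA.smul contDiffOn_const)).add (sB.smul contDiffOn_const)
  obtain ⟨τ, hτ⟩ := hVc.exists_forall_hasFDerivAt_of_fderiv_symmetric hV
    (sΩ.differentiableOn (by simp)) (by
      intro x hx u v
      obtain ⟨α, β, γ, hA, hB⟩ := h x hx
      let e (i : Fin 3) : Coord →L[ℝ] ℝ := ContinuousLinearMap.proj i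
      have := ((hA.smul_const (e 1)).const_add (e 0)).add (hB.smul_const (e 2))
      rw [HasFDerivAt.fderiv (f := Ω) this]
      simp [e]
      ring)
  refine ⟨τ, ?_, hτ⟩
  rw [contDiffOn_infty_iff_fderiv_of_isOpen hV]
  exact ⟨fun x hx => (hτ x hx).differentiableAt.differentiableWithinAt,
    sΩ.congr fun x hx => (hτ x hx).fderiv⟩

/-- This is `∂_r A = ∂_φ B` for the form `dt + A dφ + B dr` that becomes `dτ`: both `dt + H dφ` and
the model 1-form have exterior derivative `2ω` times the area form. -/
theorem closed_form_identity (vort : ℝ) {k κ D D1 N w D0 C Q : ℝ} (h1 : 1 + w ≠ 0)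
    (hw : w ^ 2 - 1 = k * (N ^ 2 + D0 ^ 2 * C ^ 2)) (hN : D * w - D1 * N = D0 * (1 - κ * Q)) :
    2 * vort * D - 2 * vort * ((D1 * N + D * w) * (1 + w)⁻¹ + D * N * (-(k * N) / (1 + w) ^ 2)) =
      2 * vort * D0 * ((1 + -κ * Q) * (1 + w)⁻¹ + C * (-(k * (D0 * D * C)) / (1 + w) ^ 2)) := by
  field_simp
  linear_combination vort * (1 + w) * hN - vort * D * hw

variable {H D : ℝ → ℝ} {U : Set Coord} {vort msq : ℝ}

/-- When `H' / D = 2ω` and `D'' / D = m²`, the metric takes the form `modelMetric` in suitable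
coordinates centred at any prescribed point. -/
theorem exists_model_coordinates (hU : IsOpen U) (hUc : IsConnected U)
    (hH : ContDiffOn ℝ ∞ H (radii U)) (hD : ContDiffOn ℝ ∞ D (radii U))
    (hh : ∀ r ∈ radii U, deriv H r = 2 * vort * D r)
    (hk : ∀ r ∈ radii U, deriv (deriv D) r = msq * D r) {p : Coord} (hp : p ∈ U) :
    ∃ (V : Set Coord) (F : Coord → Coord), IsOpen V ∧ p ∈ V ∧ V ⊆ U ∧ ContDiffOn ℝ ∞ F V ∧
      F p = 0 ∧ ∀ x ∈ V, ∀ u v : Coord,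
        modelMetric vort msq (F x) (fderiv ℝ F x u) (fderiv ℝ F x v) = metric H D x u v := by
  have hD1 := contDiffOn_deriv_radii hU hD
  obtain ⟨D0, hD0⟩ : ∃ a, a = D (p 2) := ⟨_, rfl⟩
  obtain ⟨E0, hE0⟩ : ∃ a, a = deriv D (p 2) := ⟨_, rfl⟩
  obtain ⟨S, P, hS⟩ := exists_isGenSine msq
  obtain ⟨C, Q, hC⟩ := exists_isGenSine (-(E0 ^ 2 - msq * D0 ^ 2))
  -- `f1` and `f2` vanish at `p` with orthonormal gradients, and `w` equals `1` there with zero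
  -- gradient. They satisfy `w² = 1 + m² (f1² + f2²)`, an embedding of the surface in a quadric (a
  -- plane if `m² = 0`).
  let f1 : Coord → ℝ := fun x => S (x 2 - p 2) - E0 * (D (x 2) * Q (x 1 - p 1))
  let f2 : Coord → ℝ := fun x => D (x 2) * C (x 1 - p 1)
  let w : Coord → ℝ := fun x =>
    (1 + msq * P (x 2 - p 2)) + msq * D0 * (D (x 2) * Q (x 1 - p 1))
  let N : Coord → ℝ := fun x => S (x 2 - p 2) + D0 * (deriv D (x 2) * Q (x 1 - p 1))
  let A : Coord → ℝ := fun x => H (x 2) - 2 * vort * (D (x 2) * N x * (1 + w x)⁻¹)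
  let B : Coord → ℝ := fun x => 2 * vort * D0 * (C (x 1 - p 1) * (1 + w x)⁻¹)
  have sm {G : ℝ → ℝ} (hG : ContDiff ℝ ∞ G) (i : Fin 3) :
      ContDiffOn ℝ ∞ (fun x : Coord => G (x i - p i)) U :=
    (hG.comp ((contDiff_apply ℝ ℝ i).sub contDiff_const)).contDiffOn
  have sD := contDiffOn_radial hD (subset_refl U)
  have sD1 := contDiffOn_radial hD1 (subset_refl U)
  have sH := contDiffOn_radial hH (subset_refl U)
  have sS := sm hS.contDiff_sine 2
  have sP := sm hS.contDiff_versine 2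
  have sC := sm hC.contDiff_sine 1
  have sQ := sm hC.contDiff_versine 1
  have sf1 : ContDiffOn ℝ ∞ f1 U := sS.sub (contDiffOn_const.mul (sD.mul sQ))
  have sf2 : ContDiffOn ℝ ∞ f2 U := sD.mul sC
  have sw : ContDiffOn ℝ ∞ w U :=
    (contDiffOn_const.add (contDiffOn_const.mul sP)).add (contDiffOn_const.mul (sD.mul sQ))
  have sN : ContDiffOn ℝ ∞ N U := sS.add (contDiffOn_const.mul (sD1.mul sQ))
  have hwp : w p = 1 := by simp [w, hS.versine_zero, hC.versine_zero]
  -- Positivity of `w` makes it the square root in `modelMetric`; a ball is convex, as the Poincaré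
  -- lemma requires.
  obtain ⟨δ, hδ, hball⟩ := Metric.mem_nhds_iff.1 (inter_mem (hU.mem_nhds hp)
    ((sw.continuousOn.continuousAt (hU.mem_nhds hp)).eventually (lt_mem_nhds (a := 0)
      (by rw [hwp]; exact one_pos))))
  set V := Metric.ball p δ with hVdef
  have hV : IsOpen V := Metric.isOpen_ball
  have hpV : p ∈ V := Metric.mem_ball_self hδ
  have hVU : V ⊆ U := fun x hx => (hball hx).1
  have hw0 {x : Coord} (hx : x ∈ V) : 0 < w x := (hball hx).2
  have sinv : ContDiffOn ℝ ∞ (fun x => (1 + w x)⁻¹) V :=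
    (contDiffOn_const.add (sw.mono hVU)).inv fun x hx => by linarith [hw0 hx]
  have sA : ContDiffOn ℝ ∞ A V :=
    (sH.mono hVU).sub (contDiffOn_const.mul (((sD.mul sN).mono hVU).mul sinv))
  have sB : ContDiffOn ℝ ∞ B V := contDiffOn_const.mul ((sC.mono hVU).mul sinv)
  have rel {x : Coord} (hx : x ∈ V) := by
    have hode := eq_of_second_order_ode hU hUc hD hk hS (mem_radii (hVU hx)) (mem_radii hp)
    rw [← hD0, ← hE0] at hode
    exact model_coordinate_relations (S := S (x 2 - p 2)) (c := 1 + msq * P (x 2 - p 2))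
      (Q := Q (x 1 - p 1)) (C := C (x 1 - p 1)) (w := w x) (N := N x) (f1 := f1 x) (f2 := f2 x)
      hode.1 hode.2
      (by linear_combination -msq * hS.sq (x 2 - p 2)) (by linear_combination hC.sq (x 1 - p 1))
      rfl rfl rfl rfl rfl rfl rfl rfl
  have hr {x : Coord} (hx : x ∈ V) : x 2 ∈ radii U := mem_radii (hVU hx)
  have dD {x : Coord} (hx : x ∈ V) := (differentiableAt_radii hU hD (hr hx)).hasDerivAt
  have dD1 {x : Coord} (hx : x ∈ V) : HasDerivAt (deriv D) (msq * D (x 2)) (x 2) :=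
    hk _ (hr hx) ▸ (differentiableAt_radii hU hD1 (hr hx)).hasDerivAt
  have dH {x : Coord} (hx : x ∈ V) : HasDerivAt H (2 * vort * D (x 2)) (x 2) :=
    hh _ (hr hx) ▸ (differentiableAt_radii hU hH (hr hx)).hasDerivAt
  have shift {G G' : ℝ → ℝ} (hG : ∀ s, HasDerivAt G (G' s) s) (i : Fin 3) (x : Coord) :
      HasDerivAt (fun s => G (s - p i)) (G' (x i - p i)) (x i) :=
    ((hG _).comp (x i) ((hasDerivAt_id (x i)).sub_const (p i))).congr_deriv (by simp)
  have dS (x : Coord) := hasFDerivAt_radial (shift hS.hasDerivAt_sine 2 x)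
  have dP (x : Coord) := hasFDerivAt_radial (shift hS.hasDerivAt_versine 2 x)
  have dC (x : Coord) := shift hC.hasDerivAt_sine 1 x
  have dQ (x : Coord) := shift hC.hasDerivAt_versine 1 x
  let L (a b : ℝ) : Coord →L[ℝ] ℝ := a • ContinuousLinearMap.proj (R := ℝ) (1 : Fin 3)
    + b • ContinuousLinearMap.proj (R := ℝ) (2 : Fin 3)
  have df1 {x : Coord} (hx : x ∈ V) : HasFDerivAt f1 (L (-(E0 * (D (x 2) * C (x 1 - p 1))))
      ((1 + msq * P (x 2 - p 2)) - E0 * (deriv D (x 2) * Q (x 1 - p 1)))) x := by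
    refine ((dS x).sub ((hasFDerivAt_radial_mul_angular (dD hx) (dQ x)).const_mul E0)).congr_fderiv
      ?_
    ext u
    simp [L]
    ring
  have df2 {x : Coord} (hx : x ∈ V) : HasFDerivAt f2
      (L (D (x 2) * (1 - (E0 ^ 2 - msq * D0 ^ 2) * Q (x 1 - p 1)))
        (deriv D (x 2) * C (x 1 - p 1))) x := by
    refine (hasFDerivAt_radial_mul_angular (dD hx) (dC x)).congr_fderiv ?_
    ext u
    simp [L]
    exact .inl (.inl (by ring))
  have dw {x : Coord} (hx : x ∈ V) : HasFDerivAt w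
      (L (msq * (D0 * D (x 2) * C (x 1 - p 1))) (msq * N x)) x := by
    refine ((((dP x).const_mul msq).const_add 1).add
      ((hasFDerivAt_radial_mul_angular (dD hx) (dQ x)).const_mul (msq * D0))).congr_fderiv ?_
    ext u
    simp [L, N]
    ring
  have dN {x : Coord} (hx : x ∈ V) : HasFDerivAt N
      (L (D0 * deriv D (x 2) * C (x 1 - p 1)) (w x)) x := by
    refine ((dS x).add
      ((hasFDerivAt_radial_mul_angular (dD1 hx) (dQ x)).const_mul D0)).congr_fderiv ?_
    ext u
    simp [L, w]
    ring
  have dinv {x : Coord} (hx : x ∈ V) : HasFDerivAt (fun x => (1 + w x)⁻¹)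
      (L (-(msq * (D0 * D (x 2) * C (x 1 - p 1))) / (1 + w x) ^ 2)
        (-(msq * N x) / (1 + w x) ^ 2)) x := by
    have h1 : 1 + w x ≠ 0 := by linarith [hw0 hx]
    refine ((hasDerivAt_inv h1).comp_hasFDerivAt x ((dw hx).const_add 1)).congr_fderiv ?_
    ext u
    simp [L]
    ring
  have closed : ∀ x ∈ V, ∃ α β γ : ℝ, HasFDerivAt A (L α β) x ∧ HasFDerivAt B (L β γ) x := by
    intro x hx
    have h1 : 1 + w x ≠ 0 := by linarith [hw0 hx]
    obtain ⟨⟨-, r1⟩, -, -, -, r2⟩ := rel hx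
    have dCx : HasFDerivAt (fun y : Coord => C (y 1 - p 1))
        (L (1 + -(E0 ^ 2 - msq * D0 ^ 2) * Q (x 1 - p 1)) 0) x := by
      refine (hasFDerivAt_angular (dC x)).congr_fderiv ?_
      ext u
      simp [L]
    have dA := (hasFDerivAt_radial (dH hx)).sub
      ((((hasFDerivAt_radial (dD hx)).mul (dN hx)).mul (dinv hx)).const_mul (2 * vort))
    have dB := (dCx.mul (dinv hx)).const_mul (2 * vort * D0)
    refine ⟨-(2 * vort) * (D (x 2) * (D0 * deriv D (x 2) * C (x 1 - p 1)) * (1 + w x)⁻¹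
        + D (x 2) * N x * (-(msq * (D0 * D (x 2) * C (x 1 - p 1))) / (1 + w x) ^ 2)),
      2 * vort * D0 * ((1 + -(E0 ^ 2 - msq * D0 ^ 2) * Q (x 1 - p 1)) * (1 + w x)⁻¹
        + C (x 1 - p 1) * (-(msq * (D0 * D (x 2) * C (x 1 - p 1))) / (1 + w x) ^ 2)),
      2 * vort * D0 * (C (x 1 - p 1) * (-(msq * N x) / (1 + w x) ^ 2)),
      dA.congr_fderiv ?_, dB.congr_fderiv ?_⟩
    · have key := closed_form_identity vort h1 r1 r2
      rw [← key]
      ext u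
      simp [L]
      ring
    · ext u
      simp [L]
      ring
  obtain ⟨τ, sτ, dτ⟩ := exists_primitive hV (convex_ball p δ) sA sB closed
  have dF {x : Coord} (hx : x ∈ V) := (hasFDerivAt_pi (𝕜 := ℝ) (x := x)
      (φ := fun i x => (![τ x - τ p, f1 x, f2 x] : Coord) i) (φ' := ![_, _, _])).2 (by
        intro i
        fin_cases i
        exacts [(dτ x hx).sub_const (τ p), df1 hx, df2 hx])
  refine ⟨V, fun x => ![τ x - τ p, f1 x, f2 x], hV, hpV, hVU, ?_, ?_, ?_⟩
  · refine contDiffOn_pi.2 fun i => ?_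
    fin_cases i
    exacts [sτ.sub contDiffOn_const, sf1.mono hVU, sf2.mono hVU]
  · ext i
    fin_cases i <;> simp [f1, f2, hS.sine_zero, hC.sine_zero, hC.versine_zero]
  · intro x hx u v
    obtain ⟨⟨r1, -⟩, ⟨r2, r3⟩, ⟨r4, r5⟩, ⟨r6, r7, r8⟩, -⟩ := rel hx
    rw [(dF hx).fderiv]
    refine modelMetric_eq_metric (hw0 hx) r1 r2 r3 r4 r5 r6 r7 r8 ?_ ?_ ?_ ?_ ?_ ?_ <;>
      simp [A, B]

end GodelType

/-! ### Constant quotients give local homogeneity. -/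

namespace GodelType

open Set Filter Topology

variable {H D : ℝ → ℝ} {U : Set Coord}

theorem eq_zero_of_metric_eq_zero {x u : Coord} (hD : D (x 2) ≠ 0)
    (h : ∀ v, metric H D x u v = 0) : u = 0 := by
  have h0 := h (Pi.single 0 1)
  have h1 := h (Pi.single 1 1)
  have h2 := h (Pi.single 2 1)
  simp [metric] at h0 h1 h2
  have h3 : u 1 = 0 := by
    have : D (x 2) ^ 2 * u 1 = 0 := by linear_combination h1 - H (x 2) * h0
    simpa [hD] using this
  ext i
  fin_cases i
  · have : u 0 = 0 := by rw [h3] at h0; linarith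
    exact this
  · exact h3
  · exact h2

/-- A smooth map pulling some field of bilinear forms back to the metric is, near each point, a
smooth diffeomorphism onto an open set. -/
theorem exists_openPartialHomeomorph (hD0 : ∀ r ∈ radii U, D r ≠ 0) {V : Set Coord}
    (hV : IsOpen V) (hVU : V ⊆ U) {F : Coord → Coord} (hF : ContDiffOn ℝ ∞ F V)
    {M : Coord → Coord → Coord → ℝ} (hM0 : ∀ y v, M y 0 v = 0)
    (hM : ∀ x ∈ V, ∀ u v, M (F x) (fderiv ℝ F x u) (fderiv ℝ F x v) = metric H D x u v)
    {p : Coord} (hp : p ∈ V) :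
    ∃ e : OpenPartialHomeomorph Coord Coord, p ∈ e.source ∧ e.source ⊆ V ∧ ⇑e = F ∧
      ContDiffOn ℝ ∞ e.symm e.target := by
  have hat {x : Coord} (hx : x ∈ V) : ContDiffAt ℝ ∞ F x := hF.contDiffAt (hV.mem_nhds hx)
  have hequiv : ∀ x ∈ V, ∃ F' : Coord ≃L[ℝ] Coord, HasFDerivAt F (F' : Coord →L[ℝ] Coord) x := by
    intro x hx
    -- A vector killed by the differential is orthogonal to everything, hence zero by nondegeneracy
    -- of the metric; the inverse function theorem then applies.
    have hinj : Function.Injective (fderiv ℝ F x : Coord →ₗ[ℝ] Coord) := by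
      rw [← LinearMap.ker_eq_bot, LinearMap.ker_eq_bot']
      intro u hu
      refine eq_zero_of_metric_eq_zero (H := H) (hD0 _ (mem_radii (hVU hx))) fun v => ?_
      rw [← hM x hx, show fderiv ℝ F x u = 0 from hu, hM0]
    refine ⟨(LinearEquiv.ofInjectiveEndo _ hinj).toContinuousLinearEquiv, ?_⟩
    exact ((hat hx).differentiableAt (by simp)).hasFDerivAt.congr_fderiv (by ext; rfl)
  obtain ⟨F', hF'⟩ := hequiv p hp
  set e₀ := (hat hp).toOpenPartialHomeomorph F hF' (by simp) with he₀
  have hpe : p ∈ e₀.source := (hat hp).mem_toOpenPartialHomeomorph_source hF' (by simp)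
  refine ⟨e₀.restrOpen V hV, ⟨hpe, hp⟩, inter_subset_right, rfl, fun y hy => ?_⟩
  have hx : (e₀.restrOpen V hV).symm y ∈ V :=
    ((e₀.restrOpen V hV).map_target hy).2
  obtain ⟨G', hG'⟩ := hequiv _ hx
  exact ((e₀.restrOpen V hV).contDiffAt_symm hy hG' (hat hx)).contDiffWithinAt

theorem ConstantParameters.locallyHomogeneous (hU : IsOpen U) (hUc : IsConnected U)
    (hH : ContDiffOn ℝ ∞ H (radii U)) (hD : ContDiffOn ℝ ∞ D (radii U))
    (hD0 : ∀ r ∈ radii U, D r ≠ 0) (h : ConstantParameters H D U) :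
    LocallyHomogeneous H D U := by
  obtain ⟨vort, msq, h⟩ := h
  have hh : ∀ r ∈ radii U, deriv H r = 2 * vort * D r := fun r hr =>
    (div_eq_iff (hD0 r hr)).1 (h r hr).1
  have hk : ∀ r ∈ radii U, deriv (deriv D) r = msq * D r := fun r hr =>
    (div_eq_iff (hD0 r hr)).1 (h r hr).2
  have hM0 : ∀ y v, modelMetric vort msq y 0 v = 0 := by simp [modelMetric]
  intro p hp q hq
  obtain ⟨V, F, hV, hpV, hVU, sF, hFp, hF⟩ := exists_model_coordinates hU hUc hH hD hh hk hp
  obtain ⟨W, G, hW, hqW, hWU, sG, hGq, hG⟩ := exists_model_coordinates hU hUc hH hD hh hk hq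
  obtain ⟨a, hpa, haV, rfl, sa⟩ := exists_openPartialHomeomorph hD0 hV hVU sF hM0 hF hpV
  obtain ⟨b, hqb, hbW, rfl, sb⟩ := exists_openPartialHomeomorph hD0 hW hWU sG hM0 hG hqW
  -- Both charts send their centre to `0` and pull back the same model metric, so `b⁻¹ ∘ a` is an
  -- isometry taking `p` to `q`.
  have hap : a p = b q := hFp.trans hGq.symm
  have hsrc {x : Coord} (hx : x ∈ (a.trans b.symm).source) : x ∈ a.source ∧ a x ∈ b.target := by
    simpa using hx
  have htgt {y : Coord} (hy : y ∈ (a.trans b.symm).target) : y ∈ b.source ∧ b y ∈ a.target := by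
    simpa [OpenPartialHomeomorph.trans_target] using hy
  have se : ContDiffOn ℝ ∞ (a.trans b.symm) (a.trans b.symm).source :=
    sb.comp (sF.mono fun x hx => haV (hsrc hx).1) fun x hx => (hsrc hx).2
  have se' : ContDiffOn ℝ ∞ (a.trans b.symm).symm (a.trans b.symm).target :=
    sa.comp (sG.mono fun y hy => hbW (htgt hy).1) fun y hy => (htgt hy).2
  refine ⟨a.trans b.symm, ⟨fun x hx => hVU (haV (hsrc hx).1), fun y hy => hWU (hbW (htgt hy).1),
    se, se', fun x hx u v => ?_⟩, ?_, ?_⟩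
  · have hy : (a.trans b.symm) x ∈ W := hbW (b.map_target (hsrc hx).2)
    have hbe : b ((a.trans b.symm) x) = a x := b.right_inv (hsrc hx).2
    have de := ((se.contDiffAt ((a.trans b.symm).open_source.mem_nhds hx)).differentiableAt
      (by simp)).hasFDerivAt
    have db := ((sG.contDiffAt (hW.mem_nhds hy)).differentiableAt (by simp)).hasFDerivAt
    have da := ((sF.contDiffAt (hV.mem_nhds (haV (hsrc hx).1))).differentiableAt
      (by simp)).hasFDerivAt
    have hcomp : HasFDerivAt a ((fderiv ℝ b ((a.trans b.symm) x)).comp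
        (fderiv ℝ (a.trans b.symm) x)) x :=
      (db.comp x de).congr_of_eventuallyEq <| by
        filter_upwards [(a.trans b.symm).open_source.mem_nhds hx] with z hz
        exact (b.right_inv (hsrc hz).2).symm
    have hz (z : Coord) : fderiv ℝ b ((a.trans b.symm) x) (fderiv ℝ (a.trans b.symm) x z)
        = fderiv ℝ a x z := DFunLike.congr_fun (hcomp.unique da) z
    rw [← hG _ hy, hbe, hz, hz, hF x (haV (hsrc hx).1)]
  · simpa [hpa, hap] using b.map_source hqb
  · simp [hap, b.left_inv hqb]

end GodelType

theorem theorem1 (H D : ℝ → ℝ) (U : Set GodelType.Coord)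
    (hUo : IsOpen U) (hUc : IsConnected U)
    (hH : ContDiffOn ℝ ∞ H (GodelType.radii U))
    (hD : ContDiffOn ℝ ∞ D (GodelType.radii U))
    (hD0 : ∀ r ∈ GodelType.radii U, D r ≠ 0) :
    (GodelType.LocallyHomogeneous H D U ↔ GodelType.ConstantParameters H D U) ∧
    (GodelType.HasThreeDimOrbits H D U ↔ GodelType.ConstantParameters H D U) :=
  ⟨⟨fun h => h.constantParameters hUo hUc hH hD hD0,
      fun h => h.locallyHomogeneous hUo hUc hH hD hD0⟩,
    ⟨fun h => h.constantParameters hUo hUc hH hD hD0,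
      fun h => h.hasThreeDimOrbits hUo hUc hH hD hD0⟩⟩
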